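/- All graphs are finite and undirected; parallel edges are allowed, loops are not. A graph $G=(V,E)$ is \emph{matching-covered} if every edge lies in at least one perfect matching of $G$. A \emph{half-edge $2$-colouring} $c$ of $G$ assigns to each pair $(e,w)$, where $e\in E$ and $w$ is an end of $e$, a colour in $\{0,1\}$ ($0$ = blue, $1$ = red). An edge $e=\{u,v\}$ is \emph{monochromatic} if $c(e,u)=c(e,v)$ and \emph{bichromatic} otherwise; $E_m(G)$ and $E_b(G)$ denote the sets of monochromatic and bichromatic edges. All half-edge $2$-colourings considered have no red monochromatic edge. Write $\delta(\{v\})$ for the set of edges incident with $v$. A \emph{W-state graph} is a matching-covered graph $G$ with a half-edge $2$-colouring $c$ such that $|M\cap E_b(G)|=1$ for every perfect matching $M$ of $G$, and every vertex $v$ is an end of some edge $e$ with $c(e,v)=1$. A \emph{W-cone} is a matching-covered graph $G$ with a half-edge $2$-colouring $c$ that has a vertex $v$ (the apex) adjacent to all other vertices such that $\delta(\{v\})=E_b(G)$, $E(G[V\setminus\{v\}])=E_m(G)$, and every vertex $u$ is an end of some edge $e$ with $c(e,u)=1$. \textbf{Observation.} Let $(G,c)$ be a W-state graph. If $G$ is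 $3$-connected (that is, $|V|\ge 4$ and deleting any set of at most two vertices leaves a connected graph), then $(G,c)$ is a W-cone. -/

import Mathlib

open scoped Graph

namespace Graph

/-- `G` is `k`-connected (in the sense of vertex connectivity): it has more than `k` vertices, and
deleting fewer than `k` vertices always leaves a connected graph. -/
def IsVertexConnected {α β : Type*} (G : Graph α β) (k : ℕ) : Prop :=
  (k : ℕ∞) < V(G).encard ∧
    ∀ S ⊆ V(G), S.encard < (k : ℕ∞) → (G.deleteVerts S).toSimpleGraph.Connected

/-- A perfect matching of a loopless multigraph: a set of edges such that every vertex is an end of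
exactly one of them. -/
structure IsPerfectMatching {α β : Type*} (G : Graph α β) (M : Set β) : Prop where
  subset : M ⊆ E(G)
  existsUnique : ∀ v ∈ V(G), ∃! e, e ∈ M ∧ G.Inc e v

/-- Every edge lies in at least one perfect matching. -/
def IsMatchingCovered {α β : Type*} (G : Graph α β) : Prop :=
  ∀ e ∈ E(G), ∃ M, G.IsPerfectMatching M ∧ e ∈ M

/-- A vertex that is adjacent to all other vertices. -/
def IsUniversal {α β : Type*} (G : Graph α β) (v : α) : Prop :=
  v ∈ V(G) ∧ ∀ u ∈ V(G), u ≠ v → G.Adj v u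

/-- The half-edges of a loopless multigraph: pairs `(e, w)` where `w` is an end of `e`. -/
abbrev HalfEdge {α β : Type*} (G : Graph α β) : Type _ :=
  {p : β × α // G.Inc p.1 p.2}

/-- A half-edge `2`-colouring; the colour `0` is blue and the colour `1` is red. -/
abbrev HalfEdgeColouring {α β : Type*} (G : Graph α β) : Type _ :=
  G.HalfEdge → Fin 2

namespace HalfEdgeColouring

variable {α β : Type*} {G : Graph α β}

/-- The edges whose two halves have the same colour. -/
def monochromaticEdges (c : G.HalfEdgeColouring) : Set β :=
  {e | ∃ (x y : α) (h : G.IsLink e x y), c ⟨(e, x), h.inc_left⟩ = c ⟨(e, y), h.inc_right⟩}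

/-- The edges whose two halves have different colours. -/
def bichromaticEdges (c : G.HalfEdgeColouring) : Set β :=
  E(G) \ c.monochromaticEdges

/-- Standing convention: there are no red monochromatic edges. -/
def MonochromaticBlue (c : G.HalfEdgeColouring) : Prop :=
  ∀ (e : β) (w : α) (h : G.Inc e w), e ∈ c.monochromaticEdges → c ⟨(e, w), h⟩ = 0

/-- Every vertex is incident with a red half-edge. -/
def VertexCondition (c : G.HalfEdgeColouring) : Prop :=
  ∀ v ∈ V(G), ∃ (e : β) (h : G.Inc e v), c ⟨(e, v), h⟩ = 1

/-- `(G, c)` is a W-state graph. -/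
structure IsWStateGraph (c : G.HalfEdgeColouring) : Prop where
  monochromatic_blue : c.MonochromaticBlue
  matchingCovered : G.IsMatchingCovered
  matching_condition : ∀ M, G.IsPerfectMatching M → (M ∩ c.bichromaticEdges).encard = 1
  vertex_condition : c.VertexCondition

/-- `(G, c)` is a W-cone with apex `v`. -/
structure IsWConeWithApex (c : G.HalfEdgeColouring) (v : α) : Prop where
  monochromatic_blue : c.MonochromaticBlue
  matchingCovered : G.IsMatchingCovered
  universal : G.IsUniversal v
  edges_apex : G.incidenceSet v = c.bichromaticEdges
  edges_base : E(G.induce (V(G) \ {v})) = c.monochromaticEdges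
  vertex_condition : c.VertexCondition

/-- `(G, c)` is a W-cone. -/
def IsWCone (c : G.HalfEdgeColouring) : Prop :=
  ∃ v, c.IsWConeWithApex v

end HalfEdgeColouring

end Graph

/-!
# 3-connected W-state graphs are W-cones

Every vertex of a W-state graph is an end of a bichromatic edge, and deleting the ends of a
bichromatic edge leaves a perfect matching of monochromatic edges, while there is no monochromatic
perfect matching of the whole graph. Tutte's theorem for the monochromatic edges then yields a
partition of the vertices into two odd sets `X` and `Y` such that the bichromatic edges are exactly
the edges between `X` and `Y` (`SimpleGraph.exists_cut`). Both sides are factor-critical, and no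
perfect matching contains two edges between them. These properties define a `TightPair`. Colours and
parallel edges play no further role, so that one can work in a simple graph. If one side is a
single vertex, then this vertex is the apex of a W-cone.

The main point is `TightPair.exists_leaf`: in a tight pair with more than two vertices there is a
nonempty set `D` on one side all of whose neighbours outside `D` are among two vertices `u ∈ X` and
`v ∈ Y`, and `D` can be chosen to avoid the ends of a given cross edge `xy`. If both sides have at
least two vertices, then `u` and `v` separate `D` from a vertex of the other side, which is
impossible in a 3-connected graph.

The leaf is found by induction on the number of vertices. If every cross edge meets `xy`, then
`X \ {x}` or `Y \ {y}` is a leaf. Otherwise a cross edge `x'y'` is disjoint from `xy`, and Tutte's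
theorem applies to the graph without these four vertices, which has no perfect matching. It gives a
set `T` containing `x, y, x', y'` and at least `|T| - 2` odd sets separated by `T`, which can be
taken factor-critical (`IsOddFamily.exists_critical`). A tight pair stays matchable when any two
vertices are deleted, so a family of `n > 0` of these sets has at least `n + 2` neighbours in `T`.
A minimal subfamily for which equality holds, with `x` and `y` among the neighbours, is a core
(`IsCore`). By tightness its other neighbours are all on one side, say in `X`
(`TightPair.exists_core`). The core and its neighbours except `y` form a set `Z`, a `Shore`, that
perfect matchings treat like a single vertex of `X`. Contracting `Z` to `x` yields a smaller tight
pair (`Shore.tightPair_contract`). A leaf of the latter is a leaf of the given pair, or it can be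
trimmed to one, or it can be added to `Z` to form a larger shore (`Shore.exists_leaf`).
-/

/-! ### Matchable sets -/

namespace SimpleGraph

variable {α : Type*} {G H : SimpleGraph α} {A B C D T U : Finset α} {a b : α}

/-- `G.Matchable A` says that the subgraph of `G` induced on the finite set `A` has a perfect
matching. The matching is encoded as a fixed-point-free involution of `A` along edges of `G`. -/
def Matchable (G : SimpleGraph α) (A : Finset α) : Prop :=
  ∃ m : α → α, ∀ a ∈ A, m a ∈ A ∧ G.Adj a (m a) ∧ m (m a) = a

namespace Matchable

lemma empty : G.Matchable ∅ := ⟨id, by simp⟩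

lemma mono (h : G.Matchable A) (hGH : ∀ a ∈ A, ∀ b ∈ A, G.Adj a b → H.Adj a b) :
    H.Matchable A := by
  obtain ⟨m, hm⟩ := h
  exact ⟨m, fun a ha ↦ ⟨(hm a ha).1, hGH _ ha _ (hm a ha).1 (hm a ha).2.1, (hm a ha).2.2⟩⟩

lemma even_card (h : G.Matchable A) : Even A.card := by
  obtain ⟨m, hm⟩ := h
  have := Finset.sum_involution (s := A) (f := fun _ ↦ (1 : ZMod 2)) (fun a _ ↦ m a)
    (fun _ _ ↦ by decide) (fun a ha _ ↦ (hm a ha).2.1.ne') (fun a ha ↦ (hm a ha).1)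
    (fun a ha ↦ (hm a ha).2.2)
  simpa [ZMod.natCast_eq_zero_iff_even] using this

variable [DecidableEq α]

lemma union (hA : G.Matchable A) (hB : G.Matchable B) (hAB : Disjoint A B) :
    G.Matchable (A ∪ B) := by
  obtain ⟨m, hm⟩ := hA
  obtain ⟨n, hn⟩ := hB
  refine ⟨fun a ↦ if a ∈ A then m a else n a, fun a ha ↦ ?_⟩
  have := Finset.disjoint_left.1 hAB
  grind

lemma pair (h : G.Adj a b) : G.Matchable {a, b} := by
  refine ⟨fun c ↦ if c = a then b else a, fun c hc ↦ ?_⟩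
  have := h.ne
  have := h.symm
  grind

/-- Add the edge `ab` to a perfect matching of `A \ {a, b}`. -/
lemma of_sdiff_pair (h : G.Matchable (A \ {a, b})) (hab : G.Adj a b) (ha : a ∈ A) (hb : b ∈ A) :
    G.Matchable A := by
  have := h.union (pair hab) Finset.sdiff_disjoint
  rwa [Finset.sdiff_union_of_subset (by grind)] at this

lemma exists_partner (h : G.Matchable A) (ha : a ∈ A) :
    ∃ b ∈ A, G.Adj a b ∧ G.Matchable (A \ {a, b}) := by
  obtain ⟨m, hm⟩ := h
  refine ⟨m a, (hm a ha).1, (hm a ha).2.1, m, fun c hc ↦ ?_⟩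
  have := hm a ha
  have := hm c (by grind)
  grind

/-- A perfect matching of `A` splits along `A = B ∪ C`: apart from the edges between `B` and `C`,
which pair off `U ⊆ B` with `U' ⊆ C`, it consists of perfect matchings of `B \ U` and `C \ U'`. -/
lemma exists_split (h : G.Matchable (B ∪ C)) (hBC : Disjoint B C) :
    ∃ U ⊆ B, ∃ U' ⊆ C, U.card = U'.card ∧ G.Matchable (B \ U) ∧ G.Matchable (C \ U') ∧
      (∀ u ∈ U, ∃ w ∈ U', G.Adj u w) ∧ ∀ w ∈ U', ∃ u ∈ U, G.Adj u w := by
  obtain ⟨m, hm⟩ := h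
  have hd := Finset.disjoint_left.1 hBC
  refine ⟨{u ∈ B | m u ∈ C}, by grind, {w ∈ C | m w ∈ B}, by grind, ?_, ⟨m, ?_⟩, ⟨m, ?_⟩, ?_, ?_⟩
  · refine Finset.card_bij (fun u _ ↦ m u) ?_ ?_ ?_
    · intro u hu
      have := hm u (by grind)
      grind
    · intro u hu v hv huv
      have := hm u (by grind)
      have := hm v (by grind)
      grind
    · intro w hw
      have := hm w (by grind)
      exact ⟨m w, by grind, by grind⟩
  · intro u hu
    have := hm u (by grind)
    grind
  · intro u hu
    have := hm u (by grind)
    grind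
  · intro u hu
    have := hm u (by grind)
    exact ⟨m u, by grind, by grind⟩
  · intro w hw
    have := hm w (by grind)
    exact ⟨m w, by grind, this.2.1.symm⟩

/-- By parity, a perfect matching of `A` restricts to `B ⊆ A` and to `A \ B` if `|B|` is even and all
edges between `B` and `A \ B` have the same end `v` outside `B`. -/
lemma restrict (h : G.Matchable A) (hBA : B ⊆ A) (hB : Even B.card) (v : α)
    (hv : ∀ b ∈ B, ∀ a ∈ A, a ∉ B → G.Adj b a → a = v) :
    G.Matchable B ∧ G.Matchable (A \ B) := by
  rw [← Finset.union_sdiff_of_subset hBA] at h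
  obtain ⟨U, hU, U', hU', hc, h1, h2, h3, h4⟩ := h.exists_split Finset.disjoint_sdiff
  have hU'v : U' ⊆ {v} := by
    intro w hw
    obtain ⟨u, hu, huw⟩ := h4 w hw
    have := hU' hw
    simpa using hv u (hU hu) w (by grind) (by grind) huw
  have hle := Finset.card_le_card hU'v
  have he := h1.even_card
  rw [Finset.card_sdiff_of_subset hU, Nat.even_sub (Finset.card_le_card hU)] at he
  have h0 : U.card = 0 := by
    rw [Finset.card_singleton, ← hc] at hle
    have := he.1 hB
    rcases Nat.le_one_iff_eq_zero_or_eq_one.1 hle with h | h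
    · exact h
    · rw [h] at this
      simp at this
  have h0' : U'.card = 0 := hc ▸ h0
  rw [Finset.card_eq_zero] at h0 h0'
  subst h0 h0'
  simpa using And.intro h1 h2

lemma restrict_of_closed (h : G.Matchable A) (hBA : B ⊆ A)
    (hB : ∀ b ∈ B, ∀ a ∈ A, a ∉ B → ¬ G.Adj b a) : G.Matchable B ∧ G.Matchable (A \ B) := by
  rw [← Finset.union_sdiff_of_subset hBA] at h
  obtain ⟨U, hU, U', hU', hc, h1, h2, h3, -⟩ := h.exists_split Finset.disjoint_sdiff
  have hU0 : U = ∅ := by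
    by_contra! hne
    obtain ⟨w, hw⟩ := hne
    obtain ⟨w', hw', hadj⟩ := h3 w hw
    have := hU' hw'
    exact hB w (hU hw) w' (by grind) (by grind) hadj
  have hU'0 : U' = ∅ := by
    rw [← Finset.card_eq_zero, ← hc, hU0, Finset.card_empty]
  subst hU0 hU'0
  simpa using And.intro h1 h2

lemma biUnion {ι : Type*} {s : Finset ι} {f : ι → Finset α} (h : ∀ i ∈ s, G.Matchable (f i))
    (hd : ∀ i ∈ s, ∀ j ∈ s, i ≠ j → Disjoint (f i) (f j)) : G.Matchable (s.biUnion f) := by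
  classical
  induction s using Finset.induction_on with
  | empty => simpa using empty
  | insert i s hi ih =>
    rw [Finset.biUnion_insert]
    refine (h i (by simp)).union (ih (fun j hj ↦ h j (by simp [hj]))
      (fun j hj k hk ↦ hd j (by simp [hj]) k (by simp [hk]))) ?_
    rw [Finset.disjoint_biUnion_right]
    exact fun j hj ↦ hd i (by simp) j (by simp [hj]) (by grind)

end Matchable

variable [DecidableEq α]

/-! ### Odd families and Tutte's theorem -/

/-- `K` consists of pairwise disjoint sets of odd size in `A \ T`, each of them a union of
components of the subgraph of `G` induced on `A \ T`. -/
structure IsOddFamily (G : SimpleGraph α) (A T : Finset α) (K : Finset (Finset α)) : Prop where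
  subset : ∀ k ∈ K, k ⊆ A \ T
  odd : ∀ k ∈ K, Odd k.card
  disjoint : ∀ k ∈ K, ∀ l ∈ K, k ≠ l → Disjoint k l
  closed : ∀ k ∈ K, ∀ a ∈ k, ∀ b ∈ A, G.Adj a b → b ∈ k ∨ b ∈ T

/-- The easy half of Tutte's theorem: a perfect matching sends one edge from each odd set of the
family to a vertex of `T`. -/
lemma Matchable.card_le {K : Finset (Finset α)} (h : G.Matchable A)
    (hK : G.IsOddFamily A T K) : K.card ≤ (T ∩ A).card := by
  obtain ⟨m, hm⟩ := h
  have key : ∀ k ∈ K, ∃ a ∈ k, m a ∉ k := by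
    intro k hk
    by_contra! hcon
    have hsub := hK.subset k hk
    have : G.Matchable k := ⟨m, fun a ha ↦ ⟨hcon a ha, (hm a (by grind)).2⟩⟩
    exact Nat.not_even_iff_odd.2 (hK.odd k hk) this.even_card
  rcases K.eq_empty_or_nonempty with rfl | ⟨k₀, hk₀⟩
  · simp
  have : Nonempty α := ⟨(key k₀ hk₀).choose⟩
  choose! f hf hmf using key
  refine Finset.card_le_card_of_injOn (fun k ↦ m (f k)) ?_ ?_
  · intro k hk
    have hsub := hK.subset k hk (hf k hk)
    have := hm (f k) (by grind)
    have := hK.closed k hk _ (hf k hk) _ this.1 this.2.1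
    have := hmf k hk
    grind
  · intro k hk l hl hkl
    by_contra hne
    have h1 := hK.subset k hk (hf k hk)
    have h2 := hK.subset l hl (hf l hl)
    have h1 := hm (f k) (by grind)
    have h2 := hm (f l) (by grind)
    have h3 : f k = f l := by grind
    exact Finset.disjoint_left.1 (hK.disjoint k hk l hl hne) (hf k hk) (h3 ▸ hf l hl)

/-- Tutte's theorem for the subgraph induced on a finite set of even size; by parity, the number
of odd sets exceeds that of deleted vertices by two. -/
lemma exists_isOddFamily (h : ¬ G.Matchable A) (hA : Even A.card) :
    ∃ T ⊆ A, ∃ K, G.IsOddFamily A T K ∧ T.card + 2 ≤ K.card := by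
  classical
  have hno : ∀ M : (G.induce (A : Set α)).Subgraph, ¬ M.IsPerfectMatching := by
    intro M hM
    rw [Subgraph.isPerfectMatching_iff] at hM
    choose m hm hmu using hM
    refine h ⟨fun a ↦ if ha : a ∈ A then m ⟨a, ha⟩ else a, fun a ha ↦ ?_⟩
    have h1 := hm ⟨a, ha⟩
    have h2 := hmu (m ⟨a, ha⟩) ⟨a, ha⟩ h1.symm
    have h3 : (m ⟨a, ha⟩ : α) ∈ A := (m ⟨a, ha⟩).2
    have h4 := M.adj_sub h1
    simp only [ha, h3, dif_pos, true_and]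
    exact ⟨by simpa using h4, by simp [← h2]⟩
  -- Mathlib has Tutte's theorem for graphs on a finite type; `f` turns its components into finsets.
  have htutte : ¬ ∀ u, ¬ (G.induce (A : Set α)).IsTutteViolator u := by
    rw [← tutte]
    simpa using hno
  push Not at htutte
  obtain ⟨u, hu⟩ := htutte
  set Γ := ((⊤ : (G.induce (A : Set α)).Subgraph).deleteVerts u).coe with hΓ
  have huv : u.ncard < Γ.oddComponents.ncard := hu
  let f : Γ.ConnectedComponent → Finset α :=
    fun c ↦ c.supp.toFinset.map ⟨fun v ↦ v.1.1, fun v w h ↦ Subtype.ext (Subtype.ext h)⟩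
  have hmem : ∀ c a, a ∈ f c ↔ ∃ v, v ∈ c.supp ∧ v.1.1 = a := by simp [f]
  have hcard : ∀ c, (f c).card = c.supp.ncard := by
    intro c
    rw [Finset.card_map, Set.ncard_eq_toFinset_card']
  have hfdisj : ∀ c d, c ≠ d → Disjoint (f c) (f d) := by
    intro c d hcd
    rw [Finset.disjoint_left]
    intro a hac had
    obtain ⟨v, hv, rfl⟩ := (hmem _ _).1 hac
    obtain ⟨w, hw, hvw⟩ := (hmem _ _).1 had
    obtain rfl : w = v := Subtype.ext (Subtype.ext hvw)
    exact hcd (hv.symm.trans hw)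
  have hne : ∀ c, (f c).Nonempty := by
    intro c
    obtain ⟨v, hv⟩ := c.nonempty_supp
    exact ⟨_, (hmem _ _).2 ⟨v, hv, rfl⟩⟩
  have hinj : Function.Injective f := by
    intro c d hcd
    by_contra hne'
    have := hfdisj c d hne'
    rw [hcd, disjoint_self] at this
    exact (hne d).ne_empty this
  let T : Finset α := u.toFinset.map ⟨Subtype.val, Subtype.val_injective⟩
  have hT : ∀ a, a ∈ T ↔ ∃ h : a ∈ A, ⟨a, h⟩ ∈ u := by simp [T]
  have hTcard : T.card = u.ncard := by
    rw [Finset.card_map, Set.ncard_eq_toFinset_card']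
  have hTA : T ⊆ A := fun a ha ↦ ((hT a).1 ha).1
  let K : Finset (Finset α) := Γ.oddComponents.toFinset.map ⟨f, hinj⟩
  have hKmem : ∀ k, k ∈ K ↔ ∃ c, Odd c.supp.ncard ∧ f c = k := by simp [K]
  have hKcard : K.card = Γ.oddComponents.ncard := by
    rw [Finset.card_map, Set.ncard_eq_toFinset_card']
  refine ⟨T, hTA, K, ⟨?_, ?_, ?_, ?_⟩, ?_⟩
  · intro k hk a ha
    obtain ⟨c, -, rfl⟩ := (hKmem k).1 hk
    obtain ⟨v, -, rfl⟩ := (hmem _ _).1 ha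
    have h1 : v.1.1 ∈ A := v.1.2
    have h2 := v.2
    simp only [Subgraph.deleteVerts_verts, Subgraph.verts_top, Set.mem_sdiff, Set.mem_univ,
      true_and] at h2
    exact Finset.mem_sdiff.2 ⟨h1, fun h ↦ h2 ((hT _).1 h).2⟩
  · intro k hk
    obtain ⟨c, hc, rfl⟩ := (hKmem k).1 hk
    rwa [hcard]
  · intro k hk l hl hkl
    obtain ⟨c, -, rfl⟩ := (hKmem k).1 hk
    obtain ⟨d, -, rfl⟩ := (hKmem l).1 hl
    exact hfdisj c d (by grind)
  · intro k hk a ha b hb hab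
    obtain ⟨c, -, rfl⟩ := (hKmem k).1 hk
    obtain ⟨v, hv, rfl⟩ := (hmem _ _).1 ha
    by_cases hbu : (⟨b, hb⟩ : (A : Set α)) ∈ u
    · exact Or.inr ((hT b).2 ⟨hb, hbu⟩)
    · left
      have hvu := v.2
      have hbv : (⟨b, hb⟩ : (A : Set α)) ∈
          ((⊤ : (G.induce (A : Set α)).Subgraph).deleteVerts u).verts := by
        simpa using hbu
      refine (hmem _ _).2 ⟨⟨⟨b, hb⟩, hbv⟩, ?_, rfl⟩
      have hadj : Γ.Adj v ⟨⟨b, hb⟩, hbv⟩ := by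
        simp only [hΓ, Subgraph.coe_adj, Subgraph.deleteVerts_adj]
        simp at hvu
        simpa [hbu, hvu] using hab
      exact (c.mem_supp_congr_adj hadj).1 hv
  -- `|K|` has the parity of `|A| - |T|`, hence that of `|T|`, and so it is not `|T| + 1`.
  · have hpar := Γ.odd_ncard_oddComponents
    have hVcard : Nat.card ((⊤ : (G.induce (A : Set α)).Subgraph).deleteVerts u).verts
        = A.card - T.card := by
      rw [Nat.card_coe_set_eq, Subgraph.deleteVerts_verts, Subgraph.verts_top,
        Set.ncard_sdiff (Set.subset_univ _), Set.ncard_univ, hTcard]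
      simp
    rw [hVcard, ← hKcard, Nat.odd_sub (Finset.card_le_card hTA)] at hpar
    have h1 : T.card < K.card := by rw [hTcard, hKcard]; exact huv
    rcases Nat.lt_or_ge (T.card + 1) K.card with h2 | h2
    · exact h2
    · have h3 : K.card = T.card + 1 := by omega
      rw [h3] at hpar
      grind

end SimpleGraph

/-! ### Tight pairs, cores and shores -/

namespace SimpleGraph

variable {α : Type*} [DecidableEq α] {G : SimpleGraph α} {X Y Z P A B V : Finset α}
  {x y x' y' : α}

/-- A perfect matching of a set with an odd number of vertices in `X` has an edge leaving `X`. -/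
lemma Matchable.exists_cross (hA : G.Matchable A) (hAV : A ⊆ X ∪ Y)
    (hodd : Odd (A ∩ X).card) :
    ∃ a ∈ A ∩ X, ∃ b ∈ A ∩ Y, G.Adj a b ∧ G.Matchable (A \ {a, b}) := by
  obtain ⟨m, hm⟩ := hA
  have : ∃ a ∈ A ∩ X, m a ∉ X := by
    by_contra! hcon
    have : G.Matchable (A ∩ X) := ⟨m, fun a ha ↦ by grind⟩
    exact Nat.not_even_iff_odd.2 hodd this.even_card
  obtain ⟨a, ha, hma⟩ := this
  have h1 := hm a (by grind)
  refine ⟨a, ha, m a, by grind, h1.2.1, m, fun c hc ↦ ?_⟩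
  have := hm c (by grind)
  grind

/-- The graph induced on `X ∪ Y`, seen from a tight cut: `X` and `Y` are factor-critical, every
vertex is an end of an edge between `X` and `Y`, and no perfect matching of `X ∪ Y` contains two of
these cross edges. -/
structure TightPair (G : SimpleGraph α) (X Y : Finset α) : Prop where
  disjoint : Disjoint X Y
  left : ∀ x ∈ X, G.Matchable (X.erase x)
  right : ∀ y ∈ Y, G.Matchable (Y.erase y)
  exists_adj_left : ∀ x ∈ X, ∃ y ∈ Y, G.Adj x y
  exists_adj_right : ∀ y ∈ Y, ∃ x ∈ X, G.Adj y x
  tight : ∀ x ∈ X, ∀ y ∈ Y, ∀ x' ∈ X, ∀ y' ∈ Y, x ≠ x' → y ≠ y' → G.Adj x y → G.Adj x' y' →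
    ¬ G.Matchable ((X ∪ Y) \ {x, y, x', y'})

namespace TightPair

lemma symm (h : G.TightPair X Y) : G.TightPair Y X where
  disjoint := h.disjoint.symm
  left := h.right
  right := h.left
  exists_adj_left := h.exists_adj_right
  exists_adj_right := h.exists_adj_left
  tight y hy x hx y' hy' x' hx' hyy hxx hadj hadj' hm := by
    refine h.tight x hx y hy x' hx' y' hy' hxx hyy hadj.symm hadj'.symm ?_
    convert hm using 1
    grind

lemma delete_two_left (h : G.TightPair X Y) {u v : α} (hu : u ∈ X) (hv : v ∈ X ∪ Y)
    (huv : u ≠ v) : G.Matchable ((X ∪ Y) \ {u, v}) := by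
  have hd := Finset.disjoint_left.1 h.disjoint
  rcases Finset.mem_union.1 hv with hv | hv
  · obtain ⟨w, hw, hvw, hm⟩ := (h.left u hu).exists_partner (a := v) (by grind)
    obtain ⟨z, hz, hwz⟩ := h.exists_adj_left w (by grind)
    refine Matchable.of_sdiff_pair (a := w) (b := z) ?_ hwz ?_ (by grind)
    · convert hm.union (h.right z hz) (Finset.disjoint_left.2 (by grind)) using 1
      grind
    · have := hvw.ne
      grind
  · convert (h.left u hu).union (h.right v hv) (Finset.disjoint_left.2 (by grind)) using 1
    grind

/-- A tight pair is bicritical. -/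
lemma delete_two (h : G.TightPair X Y) {u v : α} (hu : u ∈ X ∪ Y) (hv : v ∈ X ∪ Y)
    (huv : u ≠ v) : G.Matchable ((X ∪ Y) \ {u, v}) := by
  rcases Finset.mem_union.1 hu with hu | hu
  · exact h.delete_two_left hu hv huv
  · rw [Finset.union_comm] at hv ⊢
    exact h.symm.delete_two_left hu hv huv

/-- If the ends of a cross edge are deleted, no perfect matching splits into two parts with an odd
number of vertices in `X`: each part would have a cross edge. -/
lemma not_matchable_of_odd (h : G.TightPair X Y) (hx : x ∈ X) (hy : y ∈ Y) (hxy : G.Adj x y)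
    (hB : B ⊆ (X ∪ Y) \ {x, y}) (hodd : Odd (B ∩ X).card) (hBm : G.Matchable B) :
    ¬ G.Matchable ((X ∪ Y) \ (B ∪ {x, y})) := by
  intro hm
  have hd := Finset.disjoint_left.1 h.disjoint
  obtain ⟨a, ha, b, hb, hab, hm'⟩ := hBm.exists_cross (Y := Y) (by grind) hodd
  have ha' := hB (Finset.mem_of_mem_inter_left ha)
  have hb' := hB (Finset.mem_of_mem_inter_left hb)
  refine h.tight x hx y hy a (by grind) b (by grind) (by grind) (by grind) hxy hab ?_
  convert hm'.union hm (Finset.disjoint_left.2 (by grind)) using 1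
  grind

end TightPair

/-- Hall's theorem combined with factor-critical sets: if the sets in `J` can be assigned distinct
neighbours in `R`, and `|R| = |J|`, these extend to a perfect matching of `R ∪ ⋃ J`. -/
lemma matchable_of_hall {J : Finset (Finset α)} {R : Finset α} {nb : Finset α → Finset α}
    (hJ : ∀ k ∈ J, ∀ l ∈ J, k ≠ l → Disjoint k l) (hR : ∀ k ∈ J, Disjoint k R)
    (hcrit : ∀ k ∈ J, ∀ a ∈ k, G.Matchable (k.erase a))
    (hnb : ∀ k ∈ J, ∀ t ∈ nb k, t ∈ R ∧ ∃ a ∈ k, G.Adj a t) (hcard : R.card = J.card)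
    (hall : ∀ J' ⊆ J, J'.card ≤ (J'.biUnion nb).card) : G.Matchable (R ∪ J.biUnion id) := by
  have h1 : ∀ s : Finset J, s.card ≤ (s.biUnion fun k ↦ nb k).card := by
    intro s
    have := hall (s.map ⟨Subtype.val, Subtype.val_injective⟩) (by
      intro k hk
      obtain ⟨l, -, rfl⟩ := Finset.mem_map.1 hk
      exact l.2)
    rw [Finset.card_map, Finset.map_eq_image, Finset.image_biUnion] at this
    simpa using this
  obtain ⟨f, hf, hfnb⟩ := (Finset.all_card_le_biUnion_card_iff_exists_injective _).1 h1
  have himage : Finset.univ.image f = R := by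
    refine Finset.eq_of_subset_of_card_le ?_ ?_
    · intro t ht
      obtain ⟨k, -, rfl⟩ := Finset.mem_image.1 ht
      exact (hnb k k.2 _ (hfnb k)).1
    · rw [Finset.card_image_of_injective _ hf, hcard]
      simp
  have h2 : R ∪ J.biUnion id = Finset.univ.biUnion fun k : J ↦ insert (f k) k.1 := by
    rw [← himage]
    ext a
    simp only [Finset.mem_union, Finset.mem_image, Finset.mem_univ, true_and, Finset.mem_biUnion,
      id_eq, Finset.mem_insert, Subtype.exists]
    grind
  have hfR : ∀ k, f k ∈ R := fun k ↦ (hnb k k.2 _ (hfnb k)).1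
  rw [h2]
  refine Matchable.biUnion ?_ ?_
  · intro k _
    obtain ⟨-, a, ha, hadj⟩ := hnb k k.2 _ (hfnb k)
    have := Finset.disjoint_left.1 (hR k k.2)
    have h3 := hfR k
    refine Matchable.of_sdiff_pair (a := a) (b := f k) ?_ hadj (by grind) (by grind)
    convert hcrit k k.2 a ha using 1
    grind
  · intro k _ l _ hkl
    have h3 := Finset.disjoint_left.1 (hJ k k.2 l l.2 fun h ↦ hkl (Subtype.ext h))
    have h4 := Finset.disjoint_left.1 (hR k k.2)
    have h5 := Finset.disjoint_left.1 (hR l l.2)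
    have h6 := hfR k
    have h7 := hfR l
    have h8 : f k ≠ f l := fun h ↦ hkl (hf h)
    exact Finset.disjoint_left.2 (by grind)

/-- A nonempty family `J` of odd sets in the graph induced on `V`, with all its neighbours in a set
`N` of `|J| + 2` elements, among them `x` and `y`, such that `⋃ J` together with `N` is matchable
after deletion of any two elements of `N`. -/
structure IsCore (G : SimpleGraph α) (V : Finset α) (x y : α) (J : Finset (Finset α))
    (N : Finset α) : Prop where
  nonempty : J.Nonempty
  family : G.IsOddFamily V N J
  subset : N ⊆ V
  left_mem : x ∈ N
  right_mem : y ∈ N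
  card_eq : N.card = J.card + 2
  delete_two : ∀ s ∈ N, ∀ t ∈ N, s ≠ t → G.Matchable (N \ {s, t} ∪ J.biUnion id)

/-- A set `Z` with `x ∈ Z` that sends edges out only from `P ⊆ X` or to `y`, and that behaves like a
single vertex of `X` in perfect matchings: `Z` is matchable after deletion of any one element of
`P`, but never after deletion of three or more. Two elements of `P` can be deleted if `y` is added.
By `rest`, there is a vertex of `Y` besides `y` outside `Z`. -/
structure Shore (G : SimpleGraph α) (X Y : Finset α) (x y : α) (Z P : Finset α) : Prop where
  subset : Z ⊆ X ∪ Y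
  notMem : y ∉ Z
  attach_subset : P ⊆ Z
  attach_left : P ⊆ X
  mem : x ∈ P
  one_lt_card : 1 < Z.card
  even_card : Even (Z ∩ Y).card
  closed : ∀ a ∈ Z, a ∉ P → ∀ r ∈ X ∪ Y, r ∉ Z → G.Adj a r → r = y
  delete_one : ∀ s ∈ P, G.Matchable (Z.erase s)
  delete_two : ∀ s ∈ P, ∀ t ∈ P, s ≠ t → G.Matchable (insert y Z \ {s, t})
  not_matchable : ∀ U ⊆ P, 3 ≤ U.card → ¬ G.Matchable (Z \ U)
  rest : ∃ r ∈ Y, r ∉ Z ∧ r ≠ y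

/-- A core with its neighbours other than `x` and `y` in `X` yields a shore. If three or more of the
neighbours in `X` are deleted, then fewer are left than there are odd sets to match. -/
lemma IsCore.shore {J : Finset (Finset α)} {N : Finset α} (h : G.IsCore (X ∪ Y) x y J N)
    (hXY : Disjoint X Y) (hx : x ∈ X) (hy : y ∈ Y) (hNX : N \ {x, y} ⊆ X)
    (heven : ∀ k ∈ J, Even (k ∩ Y).card) (hy' : y' ∈ Y) (hyy' : y' ≠ y)
    (hJy' : y' ∉ J.biUnion id) :
    G.Shore X Y x y (N.erase y ∪ J.biUnion id) (N.erase y) := by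
  have hd := Finset.disjoint_left.1 hXY
  have hsub := h.subset
  have hx' := h.left_mem
  have hy'' := h.right_mem
  have hJsub : ∀ a ∈ J.biUnion id, a ∈ (X ∪ Y) \ N := by
    intro a ha
    obtain ⟨k, hk, hak⟩ := Finset.mem_biUnion.1 ha
    exact h.family.subset k hk hak
  have hcardP : (N.erase y).card = J.card + 1 := by
    rw [Finset.card_erase_of_mem h.right_mem, h.card_eq]
    rfl
  have hJpos := h.nonempty.card_pos
  constructor
  · grind
  · grind
  · grind
  · grind
  · grind
  · exact lt_of_lt_of_le (by omega) (Finset.card_le_card Finset.subset_union_left)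
  · have : (N.erase y ∪ J.biUnion id) ∩ Y = J.biUnion fun k ↦ k ∩ Y := by
      ext a
      simp only [Finset.mem_inter, Finset.mem_union, Finset.mem_biUnion, id]
      grind
    rw [this, Finset.card_biUnion]
    · exact Finset.even_sum _ heven
    · intro k hk l hl hkl
      exact (h.family.disjoint k hk l hl hkl).mono Finset.inter_subset_left
        Finset.inter_subset_left
  · intro a ha haP r hr hrZ har
    have haJ : a ∈ J.biUnion id := by grind
    obtain ⟨k, hk, hak⟩ := Finset.mem_biUnion.1 haJ
    rcases h.family.closed k hk a hak r hr har with hrk | hrN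
    · exact absurd (Finset.mem_union_right _ (Finset.mem_biUnion.2 ⟨k, hk, hrk⟩)) hrZ
    · grind
  · intro s hs
    convert h.delete_two s (by grind) y hy'' (by grind) using 1
    grind
  · intro s hs t ht hst
    convert h.delete_two s (by grind) t (by grind) hst using 1
    grind
  · intro U hU hU3 hm
    have hfam : G.IsOddFamily ((N.erase y ∪ J.biUnion id) \ U) N J := by
      refine ⟨fun k hk a ha ↦ ?_, h.family.odd, h.family.disjoint, fun k hk a ha b hb ↦ ?_⟩
      · have : a ∈ J.biUnion id := Finset.mem_biUnion.2 ⟨k, hk, ha⟩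
        grind
      · exact h.family.closed k hk a ha b (by grind)
    have h1 := hm.card_le hfam
    have h2 : N ∩ ((N.erase y ∪ J.biUnion id) \ U) ⊆ N.erase y \ U := by grind
    have h3 := Finset.card_le_card h2
    rw [Finset.card_sdiff_of_subset hU] at h3
    omega
  · exact ⟨y', hy', by grind, hyy'⟩

end SimpleGraph

/-! ### Families of factor-critical sets -/

namespace SimpleGraph

variable {α : Type*} [DecidableEq α] {G : SimpleGraph α} {X Y Z P A B V T : Finset α}
  {x y x' y' : α}

/-- A pair `(T, K)` with `|T| ≤ |K| + 2` can be enlarged until every set in `K` is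
factor-critical: otherwise Tutte's theorem inside a set of `K` provides a larger pair. -/
lemma IsOddFamily.exists_critical {K : Finset (Finset α)} (hTV : T ⊆ V)
    (hK : G.IsOddFamily V T K) (hc : T.card ≤ K.card + 2) :
    ∃ T' ⊆ V, T ⊆ T' ∧ ∃ K', G.IsOddFamily V T' K' ∧ T'.card ≤ K'.card + 2 ∧
      ∀ k ∈ K', ∀ a ∈ k, G.Matchable (k.erase a) := by
  classical
  -- Take `T'` of maximal size.
  let F := V.powerset.filter fun T' ↦ T ⊆ T' ∧ ∃ K', G.IsOddFamily V T' K' ∧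
    T'.card ≤ K'.card + 2
  obtain ⟨T', hT', hmax⟩ := F.exists_max_image Finset.card ⟨T, by simp [F]; grind⟩
  simp only [F, Finset.mem_filter, Finset.mem_powerset] at hT' hmax
  obtain ⟨hT'V, hTT', K', hK', hc'⟩ := hT'
  refine ⟨T', hT'V, hTT', K', hK', hc', ?_⟩
  intro k hk a ha
  by_contra hm
  have hke : Even (k.erase a).card := by
    have := hK'.odd k hk
    rw [Finset.card_erase_of_mem ha]
    exact Nat.Odd.sub_odd this odd_one
  obtain ⟨S, hS, L, hL, hSL⟩ := exists_isOddFamily hm hke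
  have hkV := hK'.subset k hk
  have hLk : ∀ l ∈ L, ∀ b ∈ l, b ∈ k ∧ b ≠ a ∧ b ∉ S := by
    intro l hl b hb
    have := hL.subset l hl hb
    grind
  have hdisj : ∀ l ∈ L, ∀ k' ∈ K', k' ≠ k → Disjoint l k' := by
    intro l hl k' hk' hne
    refine Finset.disjoint_left.2 fun b hb hb' ↦ ?_
    exact Finset.disjoint_left.1 (hK'.disjoint k' hk' k hk hne) hb' (hLk l hl b hb).1
  -- Otherwise add `a` and the Tutte set `S` to `T'`, and replace `k` by odd sets in it.
  have hfam : G.IsOddFamily V (insert a (T' ∪ S)) (K'.erase k ∪ L) := by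
    constructor
    · intro k' hk' b hb
      rcases Finset.mem_union.1 hk' with hk' | hk'
      · have h1 := hK'.subset k' (by grind) hb
        have h2 := Finset.disjoint_left.1
          (hK'.disjoint k' (by grind) k hk (by grind)) hb
        grind
      · have h1 := hLk k' hk' b hb
        grind
    · intro k' hk'
      rcases Finset.mem_union.1 hk' with hk' | hk'
      · exact hK'.odd k' (by grind)
      · exact hL.odd k' hk'
    · intro k₁ h₁ k₂ h₂ hne
      rcases Finset.mem_union.1 h₁ with h₁ | h₁ <;> rcases Finset.mem_union.1 h₂ with h₂ | h₂
      · exact hK'.disjoint _ (by grind) _ (by grind) hne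
      · exact (hdisj _ h₂ _ (by grind) (by grind)).symm
      · exact hdisj _ h₁ _ (by grind) (by grind)
      · exact hL.disjoint _ h₁ _ h₂ hne
    · intro k' hk' b hb c hc hbc
      rcases Finset.mem_union.1 hk' with hk' | hk'
      · have := hK'.closed k' (by grind) b hb c hc hbc
        grind
      · have h1 := hLk k' hk' b hb
        have h2 := hK'.closed k hk b h1.1 c hc hbc
        by_cases hca : c ∈ k.erase a
        · have := hL.closed k' hk' b hb c hca hbc
          grind
        · grind
  have hcardT : (insert a (T' ∪ S)).card = T'.card + S.card + 1 := by
    rw [Finset.card_insert_of_notMem (by grind), Finset.card_union_of_disjoint]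
    exact Finset.disjoint_left.2 (by grind)
  have hcardK : (K'.erase k ∪ L).card = K'.card - 1 + L.card := by
    rw [Finset.card_union_of_disjoint, Finset.card_erase_of_mem hk]
    refine Finset.disjoint_left.2 fun l hl hl' ↦ ?_
    have h1 := hdisj l hl' l (by grind) (by grind)
    rw [Finset.disjoint_self_iff_empty] at h1
    have h2 := hL.odd l hl'
    simp [h1] at h2
  have hKpos := Finset.card_pos.2 ⟨k, hk⟩
  have := hmax (insert a (T' ∪ S)) ⟨by grind, by grind, _, hfam, by omega⟩
  omega

namespace TightPair

/-- As a tight pair is bicritical, a nonempty odd family has at least two more neighbours than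
members. -/
lemma add_two_le_card {J : Finset (Finset α)} {N : Finset α} (h : G.TightPair X Y)
    (hJ : G.IsOddFamily (X ∪ Y) N J) (hne : J.Nonempty) (hNT : N ⊆ T) (hT : T ⊆ X ∪ Y)
    (hJT : ∀ k ∈ J, Disjoint k T) (hT2 : 2 ≤ T.card) : J.card + 2 ≤ N.card := by
  -- If `N` has fewer than two elements, fill it up from `T`, to have two vertices to delete.
  obtain ⟨A, hNA, hAT, hA⟩ := Finset.exists_subsuperset_card_eq hNT (le_max_left N.card 2)
    (max_le (Finset.card_le_card hNT) hT2)
  obtain ⟨u, hu, v, hv, huv⟩ := Finset.one_lt_card.1 (show 1 < A.card by grind)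
  have hm := h.delete_two (hT (hAT hu)) (hT (hAT hv)) huv
  have hfam : G.IsOddFamily ((X ∪ Y) \ {u, v}) A J := by
    refine ⟨fun k hk a ha ↦ ?_, hJ.odd, hJ.disjoint, fun k hk a ha b hb hab ↦ ?_⟩
    · have h1 := hJ.subset k hk ha
      have h2 := Finset.disjoint_left.1 (hJT k hk) ha
      grind
    · have := hJ.closed k hk a ha b (by grind) hab
      grind
  have h1 := hm.card_le hfam
  have h2 : A ∩ ((X ∪ Y) \ {u, v}) ⊆ A \ {u, v} := by grind
  have h3 := Finset.card_le_card h2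
  rw [Finset.card_sdiff_of_subset (by grind), Finset.card_pair huv] at h3
  have := hne.card_pos
  grind

end TightPair
end SimpleGraph

/-! ### Construction of a shore -/

namespace SimpleGraph

variable {α : Type*} [DecidableEq α] {G : SimpleGraph α} {X Y Z P A B V T : Finset α}
  {x y x' y' : α}

/-- A perfect matching of `V \ {x, y}` needs all of `N \ {x, y}` to match the odd sets in `J`, so
that the vertices outside the core are matched among themselves. -/
lemma IsCore.matchable_compl {J : Finset (Finset α)} {N : Finset α} (h : G.IsCore V x y J N)
    (hxy : x ≠ y) (hm : G.Matchable (V \ {x, y})) : G.Matchable (V \ (N ∪ J.biUnion id)) := by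
  have hJsub : ∀ a ∈ J.biUnion id, a ∈ V \ N := by
    intro a ha
    obtain ⟨k, hk, hak⟩ := Finset.mem_biUnion.1 ha
    exact h.family.subset k hk hak
  have hx := h.left_mem
  have hy := h.right_mem
  have hNV := h.subset
  have hsplit : V \ {x, y} = (N \ {x, y} ∪ J.biUnion id) ∪ V \ (N ∪ J.biUnion id) := by grind
  rw [hsplit] at hm
  obtain ⟨U, hU, U', hU', hc, h1, h2, h3, -⟩ := hm.exists_split (Finset.disjoint_left.2 (by grind))
  have hUN : U ⊆ N \ {x, y} := by
    intro u hu
    by_contra hu'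
    have huJ : u ∈ J.biUnion id := by grind
    obtain ⟨k, hk, huk⟩ := Finset.mem_biUnion.1 huJ
    obtain ⟨w, hw, huw⟩ := h3 u hu
    have hwc := hU' hw
    rcases h.family.closed k hk u huk w (by grind) huw with hw' | hw'
    · have : w ∈ J.biUnion id := Finset.mem_biUnion.2 ⟨k, hk, hw'⟩
      grind
    · grind
  have hfam : G.IsOddFamily ((N \ {x, y} ∪ J.biUnion id) \ U) N J := by
    refine ⟨fun k hk a ha ↦ ?_, h.family.odd, h.family.disjoint, fun k hk a ha b hb ↦ ?_⟩
    · have : a ∈ J.biUnion id := Finset.mem_biUnion.2 ⟨k, hk, ha⟩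
      grind
    · exact h.family.closed k hk a ha b (by grind)
  have h4 := h1.card_le hfam
  have h5 : N ∩ ((N \ {x, y} ∪ J.biUnion id) \ U) ⊆ (N \ {x, y}) \ U := by grind
  have h6 := Finset.card_le_card h5
  rw [Finset.card_sdiff_of_subset hUN, Finset.card_sdiff_of_subset (by grind), h.card_eq,
    Finset.card_pair hxy] at h6
  have hpos := h.nonempty.card_pos
  have hU0 : U'.card = 0 := by omega
  rw [Finset.card_eq_zero] at hU0
  simpa [hU0] using h2

/-- The vertices of `T` with a neighbour in `k`. -/
noncomputable def nbrsIn (G : SimpleGraph α) (T k : Finset α) : Finset α := by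
  classical exact T.filter fun t ↦ ∃ a ∈ k, G.Adj a t

omit [DecidableEq α] in
lemma mem_nbrsIn {k : Finset α} {t : α} : t ∈ G.nbrsIn T k ↔ t ∈ T ∧ ∃ a ∈ k, G.Adj a t := by
  simp [nbrsIn]

/-- The core of an edge `xy` of a tight pair: a minimal subfamily `J` of a critical odd family with
at most `|J|` neighbours besides `x` and `y`. As it has at least `|J| + 2` neighbours, `x` and `y`
are among them. -/
lemma TightPair.exists_minimal_core {K : Finset (Finset α)} (h : G.TightPair X Y)
    (hxy : x ≠ y) (hTV : T ⊆ X ∪ Y) (hxT : x ∈ T) (hyT : y ∈ T) (hT : 2 < T.card)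
    (hK : G.IsOddFamily (X ∪ Y) T K) (hc : T.card ≤ K.card + 2)
    (hcrit : ∀ k ∈ K, ∀ a ∈ k, G.Matchable (k.erase a)) :
    ∃ J ⊆ K, G.IsCore (X ∪ Y) x y J (J.biUnion (G.nbrsIn T)) ∧
      ∀ J' ⊆ J, J'.Nonempty → J' ≠ J → J'.card < (J'.biUnion (G.nbrsIn T) \ {x, y}).card := by
  classical
  have hNbT : ∀ J : Finset (Finset α), J.biUnion (G.nbrsIn T) ⊆ T := by
    intro J t ht
    obtain ⟨k, -, hk⟩ := Finset.mem_biUnion.1 ht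
    exact (mem_nbrsIn.1 hk).1
  have hKT : ∀ k ∈ K, ∀ a ∈ k, a ∈ X ∪ Y ∧ a ∉ T := by
    intro k hk a ha
    simpa using hK.subset k hk ha
  let F := K.powerset.filter fun J ↦ J.Nonempty ∧ (J.biUnion (G.nbrsIn T) \ {x, y}).card ≤ J.card
  have hKF : K ∈ F := by
    simp only [F, Finset.mem_filter, Finset.mem_powerset, subset_refl, true_and]
    constructor
    · rw [← Finset.card_pos]
      omega
    · refine (Finset.card_le_card (Finset.sdiff_subset_sdiff (hNbT K) subset_rfl)).trans ?_
      rw [Finset.card_sdiff_of_subset (by grind), Finset.card_pair hxy]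
      omega
  obtain ⟨J, hJ, hmin⟩ := F.exists_min_image Finset.card ⟨K, hKF⟩
  simp only [F, Finset.mem_filter, Finset.mem_powerset] at hJ hmin
  obtain ⟨hJK, hJne, hJc⟩ := hJ
  set N := J.biUnion (G.nbrsIn T) with hN
  have hfamily : ∀ J' ⊆ K, G.IsOddFamily (X ∪ Y) (J'.biUnion (G.nbrsIn T)) J' := by
    intro J' hJ'
    refine ⟨fun k hk a ha ↦ ?_, fun k hk ↦ hK.odd k (hJ' hk),
      fun k hk l hl ↦ hK.disjoint k (hJ' hk) l (hJ' hl), fun k hk a ha b hb hab ↦ ?_⟩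
    · have h1 := hKT k (hJ' hk) a ha
      have h2 := @hNbT J' a
      grind
    · refine (hK.closed k (hJ' hk) a ha b hb hab).imp_right fun hbT ↦ ?_
      exact Finset.mem_biUnion.2 ⟨k, hk, mem_nbrsIn.2 ⟨hbT, a, ha, hab⟩⟩
  have hsur : ∀ J' ⊆ J, J'.Nonempty → J'.card + 2 ≤ (J'.biUnion (G.nbrsIn T)).card := by
    intro J' hJ' hne
    refine h.add_two_le_card (hfamily J' (hJ'.trans hJK)) hne (hNbT J') hTV ?_ (by omega)
    exact fun k hk ↦ Finset.disjoint_left.2 fun a ha ↦ (hKT k (hJK (hJ' hk)) a ha).2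
  have hlt : ∀ J' ⊆ J, J'.Nonempty → J' ≠ J →
      J'.card < (J'.biUnion (G.nbrsIn T) \ {x, y}).card := by
    intro J' hJ' hne hne'
    by_contra! hle
    have := hmin J' ⟨hJ'.trans hJK, hne, hle⟩
    exact hne' (Finset.eq_of_subset_of_card_le hJ' this)
  have hNT : N ⊆ T := hNbT J
  have hcardN : (N \ {x, y}).card + (N ∩ {x, y}).card = N.card :=
    Finset.card_sdiff_add_card_inter N {x, y}
  have h2 : (N ∩ {x, y}).card ≤ 2 :=
    (Finset.card_le_card Finset.inter_subset_right).trans Finset.card_le_two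
  have hNJ : J.card + 2 ≤ N.card := hsur J subset_rfl hJne
  have hinter : N ∩ {x, y} = {x, y} :=
    Finset.eq_of_subset_of_card_le Finset.inter_subset_right (by
      rw [Finset.card_pair hxy]
      omega)
  have hxN : x ∈ N := by grind
  have hyN : y ∈ N := by grind
  have hJN : ∀ k ∈ J, ∀ a ∈ k, a ∉ N := fun k hk a ha haN ↦ (hKT k (hJK hk) a ha).2 (hNT haN)
  refine ⟨J, hJK, (?_ : G.IsCore (X ∪ Y) x y J N), hlt⟩
  refine ⟨hJne, hfamily J hJK, hNT.trans hTV, hxN, hyN, by omega, ?_⟩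
  intro s hs t ht hst
  refine matchable_of_hall (nb := fun k ↦ G.nbrsIn T k \ {s, t})
    (fun k hk l hl ↦ hK.disjoint k (hJK hk) l (hJK hl)) ?_ (fun k hk ↦ hcrit k (hJK hk)) ?_ ?_ ?_
  · exact fun k hk ↦ Finset.disjoint_left.2 fun a ha ha' ↦ hJN k hk a ha (by grind)
  · intro k hk u hu
    have h1 : u ∈ G.nbrsIn T k := by grind
    have h2 : u ∈ N := Finset.mem_biUnion.2 ⟨k, hk, h1⟩
    exact ⟨by grind, (mem_nbrsIn.1 h1).2⟩
  · rw [Finset.card_sdiff_of_subset (by grind), Finset.card_pair hst]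
    omega
  · intro J' hJ'
    rcases J'.eq_empty_or_nonempty with rfl | hne
    · simp
    · have h1 : J'.biUnion (fun k ↦ G.nbrsIn T k \ {s, t}) = J'.biUnion (G.nbrsIn T) \ {s, t} := by
        ext a
        simp only [Finset.mem_biUnion, Finset.mem_sdiff, ← exists_and_right, and_assoc]
      have h2 := hsur J' hJ' hne
      have h3 := Finset.le_card_sdiff {s, t} (J'.biUnion (G.nbrsIn T))
      rw [Finset.card_pair hst] at h3
      rw [h1]
      omega

/-- By minimality of the core, deleting `x` and `y`, a member `k` of the core and any other vertex
of its neighbourhood leaves a matchable set. -/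
lemma TightPair.matchable_sdiff_core {K J : Finset (Finset α)} (h : G.TightPair X Y)
    (hxy : x ≠ y) (hK : G.IsOddFamily (X ∪ Y) T K)
    (hcrit : ∀ k ∈ K, ∀ a ∈ k, G.Matchable (k.erase a)) (hJK : J ⊆ K)
    (hcore : G.IsCore (X ∪ Y) x y J (J.biUnion (G.nbrsIn T)))
    (hlt : ∀ J' ⊆ J, J'.Nonempty → J' ≠ J → J'.card < (J'.biUnion (G.nbrsIn T) \ {x, y}).card)
    {k : Finset α} (hk : k ∈ J) {s : α} (hs : s ∈ J.biUnion (G.nbrsIn T) \ {x, y}) :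
    G.Matchable ((X ∪ Y) \ (k ∪ {s} ∪ {x, y})) := by
  have hNbT : ∀ J : Finset (Finset α), J.biUnion (G.nbrsIn T) ⊆ T := by
    intro J t ht
    obtain ⟨k, -, hk⟩ := Finset.mem_biUnion.1 ht
    exact (mem_nbrsIn.1 hk).1
  have hKT : ∀ k ∈ K, ∀ a ∈ k, a ∈ X ∪ Y ∧ a ∉ T := by
    intro k hk a ha
    simpa using hK.subset k hk ha
  set N := J.biUnion (G.nbrsIn T) with hN
  have hNT : N ⊆ T := hNbT J
  have hJN : ∀ k ∈ J, ∀ a ∈ k, a ∉ N := fun k hk a ha haN ↦ (hKT k (hJK hk) a ha).2 (hNT haN)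
  have hrest := hcore.matchable_compl hxy
    (h.delete_two (hcore.subset hcore.left_mem) (hcore.subset hcore.right_mem) hxy)
  have hNc : (N \ {x, y}).card = J.card := by
    have h1 := hcore.left_mem
    have h2 := hcore.right_mem
    rw [Finset.card_sdiff_of_subset (by grind), hcore.card_eq, Finset.card_pair hxy]
    rfl
  have h1 : G.Matchable ((N \ {x, y}).erase s ∪ (J.erase k).biUnion id) := by
    refine matchable_of_hall (nb := fun k ↦ (G.nbrsIn T k \ {x, y}).erase s)
      (fun k hk l hl ↦ hK.disjoint k (hJK (by grind)) l (hJK (by grind))) ?_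
      (fun k hk ↦ hcrit k (hJK (by grind))) ?_ ?_ ?_
    · exact fun k hk ↦ Finset.disjoint_left.2 fun a ha ha' ↦ hJN k (by grind) a ha (by grind)
    · intro k hk u hu
      have h1 : u ∈ G.nbrsIn T k := by grind
      have h2 : u ∈ N := Finset.mem_biUnion.2 ⟨k, by grind, h1⟩
      exact ⟨by grind, (mem_nbrsIn.1 h1).2⟩
    · rw [Finset.card_erase_of_mem hs, Finset.card_erase_of_mem hk]
      omega
    · intro J' hJ'
      rcases J'.eq_empty_or_nonempty with rfl | hne
      · simp
      · have h1 : J'.biUnion (fun k ↦ (G.nbrsIn T k \ {x, y}).erase s) =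
            (J'.biUnion (G.nbrsIn T) \ {x, y}).erase s := by
          ext a
          aesop
        have h2 := hlt J' (by grind) hne (by grind)
        have h3 := Finset.pred_card_le_card_erase (s := J'.biUnion (G.nbrsIn T) \ {x, y}) (a := s)
        rw [h1]
        omega
  have hkJ : ∀ b, b ∈ J.biUnion id ↔ b ∈ k ∨ b ∈ (J.erase k).biUnion id := by
    intro b
    simp only [Finset.mem_biUnion, Finset.mem_erase, id]
    grind
  have hkJ' : ∀ b ∈ k, b ∉ (J.erase k).biUnion id := by
    intro b hb hb'
    obtain ⟨l, hl, hbl⟩ := Finset.mem_biUnion.1 hb'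
    exact Finset.disjoint_left.1 (hK.disjoint k (hJK hk) l (hJK (by grind)) (by grind)) hb hbl
  have hJV : ∀ b ∈ J.biUnion id, b ∈ X ∪ Y ∧ b ∉ N := by
    intro b hb
    obtain ⟨l, hl, hbl⟩ := Finset.mem_biUnion.1 hb
    exact ⟨(hKT l (hJK hl) b hbl).1, hJN l hl b hbl⟩
  have hNV := hcore.subset
  have hxN := hcore.left_mem
  have hyN := hcore.right_mem
  have hkN := hJN k hk
  clear hcore hlt hJN hKT hNbT hN hNc
  clear_value N
  generalize J.biUnion id = W at *
  generalize (J.erase k).biUnion id = W' at *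
  convert h1.union hrest (Finset.disjoint_left.2 ?_) using 1
  · ext b
    have := hkJ b
    have := hkJ' b
    have := hJV b
    have := @hNV b
    have := hkN b
    grind
  · intro b hb
    have := hkJ b
    grind

/-- An edge between a member `k` of the core and a neighbour `s` of it, other than `x` and `y`, is
no cross edge, and the rest of `k` has evenly many vertices on each side: otherwise some perfect
matching would contain two cross edges, one of them `xy`. -/
lemma TightPair.core_side {K J : Finset (Finset α)} (h : G.TightPair X Y)
    (hx : x ∈ X) (hy : y ∈ Y) (hxy : G.Adj x y)
    (hK : G.IsOddFamily (X ∪ Y) T K)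
    (hcrit : ∀ k ∈ K, ∀ a ∈ k, G.Matchable (k.erase a)) (hJK : J ⊆ K)
    (hcore : G.IsCore (X ∪ Y) x y J (J.biUnion (G.nbrsIn T)))
    (hlt : ∀ J' ⊆ J, J'.Nonempty → J' ≠ J → J'.card < (J'.biUnion (G.nbrsIn T) \ {x, y}).card)
    {k : Finset α} (hk : k ∈ J) {a s : α} (ha : a ∈ k)
    (hs : s ∈ J.biUnion (G.nbrsIn T) \ {x, y}) (has : G.Adj a s) :
    (a ∈ X ↔ s ∈ X) ∧ Even (k.erase a ∩ X).card := by
  have hd := Finset.disjoint_left.1 h.disjoint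
  have hm := h.matchable_sdiff_core hxy.ne hK hcrit hJK hcore hlt hk hs
  have hKT : ∀ k ∈ K, ∀ a ∈ k, a ∈ X ∪ Y ∧ a ∉ T := by
    intro k hk a ha
    simpa using hK.subset k hk ha
  set N := J.biUnion (G.nbrsIn T) with hN
  have hxN := hcore.left_mem
  have hyN := hcore.right_mem
  have hJN : ∀ k ∈ J, ∀ a ∈ k, a ∉ N := fun k hk a ha haN ↦
    (Finset.mem_sdiff.1 (hcore.family.subset k hk ha)).2 haN
  have haV := (hKT k (hJK hk) a ha).1
  have hsV : s ∈ X ∪ Y := hcore.subset (by grind)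
  have hkN := hJN k hk
  have hkV : ∀ b ∈ k, b ∈ X ∪ Y := fun b hb ↦ (hKT k (hJK hk) b hb).1
  have haN := hJN k hk a ha
  have hcr := hcrit k (hJK hk) a ha
  have hsN : s ∈ N ∧ s ≠ x ∧ s ≠ y := by simpa using hs
  have hxk : x ∉ k := fun h ↦ hkN x h hxN
  have hyk : y ∉ k := fun h ↦ hkN y h hyN
  have hsk : s ∉ k := fun h ↦ hkN s h hsN.1
  clear hcore hlt hJN hKT hN hcrit hkN hs
  clear_value N
  constructor
  · by_contra hne
    have hm' : G.Matchable ((X ∪ Y) \ ({a, s} ∪ {x, y})) := by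
      convert hcr.union hm (Finset.disjoint_left.2 (by grind)) using 1
      ext w
      have := hkV w
      simp only [Finset.mem_sdiff, Finset.mem_union, Finset.mem_insert, Finset.mem_singleton,
        Finset.mem_erase]
      grind
    rcases Finset.mem_union.1 haV with haX | haY
    · refine h.tight x hx y hy a haX s (by grind) (by grind) (by grind) hxy has ?_
      convert hm' using 1
      grind
    · refine h.tight x hx y hy s (by grind) a haY (by grind) (by grind) hxy has.symm ?_
      convert hm' using 1
      grind
  · by_contra hodd
    rw [Nat.not_even_iff_odd] at hodd
    refine h.not_matchable_of_odd hx hy hxy (by grind) hodd hcr ?_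
    refine Matchable.of_sdiff_pair (a := a) (b := s) ?_ has (by grind) (by grind)
    convert hm using 1
    grind

/-- For a cross edge `xy` there is a core whose neighbours other than `x` and `y` all lie on one
side. Otherwise the members split into those with an odd number of vertices in `X`, whose
neighbours are in `X`, and those with neighbours in `Y`, against the minimality of the core. -/
lemma TightPair.exists_core {K : Finset (Finset α)} (h : G.TightPair X Y) (hx : x ∈ X) (hy : y ∈ Y)
    (hxy : G.Adj x y) (hTV : T ⊆ X ∪ Y) (hxT : x ∈ T) (hyT : y ∈ T) (hT : 2 < T.card)
    (hK : G.IsOddFamily (X ∪ Y) T K) (hc : T.card ≤ K.card + 2)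
    (hcrit : ∀ k ∈ K, ∀ a ∈ k, G.Matchable (k.erase a)) :
    ∃ J ⊆ K, ∃ N ⊆ T, G.IsCore (X ∪ Y) x y J N ∧
      ((N \ {x, y} ⊆ X ∧ ∀ k ∈ J, Even (k ∩ Y).card) ∨
        (N \ {x, y} ⊆ Y ∧ ∀ k ∈ J, Even (k ∩ X).card)) := by
  classical
  obtain ⟨J, hJK, hcore, hlt⟩ := h.exists_minimal_core hxy.ne hTV hxT hyT hT hK hc hcrit
  have hKT : ∀ k ∈ K, ∀ a ∈ k, a ∈ X ∪ Y ∧ a ∉ T := by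
    intro k hk a ha
    simpa using hK.subset k hk ha
  have hside : ∀ k ∈ J, ∀ a ∈ k, ∀ s ∈ J.biUnion (G.nbrsIn T) \ {x, y}, G.Adj a s →
      (a ∈ X ↔ s ∈ X) ∧ Even (k.erase a ∩ X).card := fun k hk a ha s hs has ↦
    h.core_side hx hy hxy hK hcrit hJK hcore hlt hk ha hs has
  have hd := Finset.disjoint_left.1 h.disjoint
  set N := J.biUnion (G.nbrsIn T) with hN
  have hxN := hcore.left_mem
  have hyN := hcore.right_mem
  have hNT : N ⊆ T := by
    intro t ht
    obtain ⟨k, -, hk⟩ := Finset.mem_biUnion.1 ht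
    exact (mem_nbrsIn.1 hk).1
  have hNc : (N \ {x, y}).card = J.card := by
    rw [Finset.card_sdiff_of_subset (by grind), hcore.card_eq, Finset.card_pair hxy.ne]
    rfl
  refine ⟨J, hJK, N, hNT, hcore, ?_⟩
  -- The members of `J` with an odd number of vertices in `X`, and the others.
  set J₁ := J.filter fun k ↦ Odd (k ∩ X).card with hJ₁
  set J₂ := J.filter fun k ↦ ¬ Odd (k ∩ X).card with hJ₂
  have hcard : J₁.card + J₂.card = J.card := Finset.card_filter_add_card_filter_not _
  have hN₁ : J₁.biUnion (G.nbrsIn T) \ {x, y} ⊆ (N \ {x, y}) ∩ X := by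
    intro s hs
    obtain ⟨hs, hs'⟩ := Finset.mem_sdiff.1 hs
    obtain ⟨k, hk, hks⟩ := Finset.mem_biUnion.1 hs
    obtain ⟨a, ha, has⟩ := (mem_nbrsIn.1 hks).2
    have hkJ : k ∈ J := by grind
    have hsN : s ∈ N := Finset.mem_biUnion.2 ⟨k, hkJ, hks⟩
    obtain ⟨h1, h2⟩ := hside k hkJ a ha s (by grind) has
    have : a ∈ X := by
      by_contra haX
      rw [Finset.erase_inter, Finset.erase_eq_of_notMem (by grind)] at h2
      grind
    grind
  have hN₂ : J₂.biUnion (G.nbrsIn T) \ {x, y} ⊆ (N \ {x, y}) \ X := by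
    intro s hs
    obtain ⟨hs, hs'⟩ := Finset.mem_sdiff.1 hs
    obtain ⟨k, hk, hks⟩ := Finset.mem_biUnion.1 hs
    obtain ⟨a, ha, has⟩ := (mem_nbrsIn.1 hks).2
    have hkJ : k ∈ J := by grind
    have hsN : s ∈ N := Finset.mem_biUnion.2 ⟨k, hkJ, hks⟩
    obtain ⟨h1, h2⟩ := hside k hkJ a ha s (by grind) has
    have : a ∉ X := by
      intro haX
      have hpos : 0 < (k ∩ X).card := Finset.card_pos.2 ⟨a, by grind⟩
      rw [Finset.erase_inter, Finset.card_erase_of_mem (by grind), Nat.even_sub (by omega)] at h2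
      grind
    grind
  have hc₁ := Finset.card_le_card hN₁
  have hc₂ := Finset.card_le_card hN₂
  have hc₃ : ((N \ {x, y}) \ X).card + ((N \ {x, y}) ∩ X).card = (N \ {x, y}).card :=
    Finset.card_sdiff_add_card_inter _ _
  have hor : J₁ = ∅ ∨ J₂ = ∅ := by
    by_contra! hne
    have hp₁ := hne.1.card_pos
    have hp₂ := hne.2.card_pos
    have h1 := hlt J₁ (Finset.filter_subset _ _) hne.1 fun h ↦ by
      rw [h] at hcard
      omega
    have h2 := hlt J₂ (Finset.filter_subset _ _) hne.2 fun h ↦ by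
      rw [h] at hcard
      omega
    omega
  have hYX : ∀ k ∈ J, (k ∩ X).card + (k ∩ Y).card = k.card := by
    intro k hk
    rw [← Finset.card_union_of_disjoint (Finset.disjoint_left.2 (by grind)),
      ← Finset.inter_union_distrib_left]
    congr 1
    exact Finset.inter_eq_left.2 fun a ha ↦ (hKT k (hJK hk) a ha).1
  rcases hor with h0 | h0
  · right
    have hJJ : J₂ = J :=
      Finset.eq_of_subset_of_card_le (Finset.filter_subset _ _) (by simp [← hcard, h0])
    rw [hJJ] at hN₂
    constructor
    · intro s hs
      have h1 := hN₂ hs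
      have h2 := hcore.subset (Finset.mem_sdiff.1 hs).1
      grind
    · intro k hk
      rw [← Nat.not_odd_iff_even]
      grind
  · left
    have hJJ : J₁ = J :=
      Finset.eq_of_subset_of_card_le (Finset.filter_subset _ _) (by simp [← hcard, h0])
    rw [hJJ] at hN₁
    refine ⟨fun s hs ↦ (Finset.mem_inter.1 (hN₁ hs)).2, fun k hk ↦ ?_⟩
    have h1 := hYX k hk
    have h2 := hK.odd k (hJK hk)
    have h3 : Odd (k ∩ X).card := by grind
    rw [← h1, Nat.odd_add] at h2
    exact h2.1 h3

/-- Two disjoint cross edges yield a shore on one of the two sides: Tutte's theorem, applied to the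
graph without their ends, provides a set that contains a core. -/
lemma TightPair.exists_shore (h : G.TightPair X Y) (hx : x ∈ X) (hy : y ∈ Y) (hx' : x' ∈ X)
    (hy' : y' ∈ Y) (hxx' : x ≠ x') (hyy' : y ≠ y') (hxy : G.Adj x y) (hxy' : G.Adj x' y') :
    (∃ Z P, G.Shore X Y x y Z P) ∨ ∃ Z P, G.Shore Y X y x Z P := by
  have hd := Finset.disjoint_left.1 h.disjoint
  have hcard4 : ({x, y, x', y'} : Finset α).card = 4 := by
    rw [Finset.card_insert_of_notMem, Finset.card_insert_of_notMem, Finset.card_pair] <;> grind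
  have heven : Even ((X ∪ Y) \ {x, y, x', y'}).card := by
    have h1 := (h.delete_two (by grind) (by grind) hxy.ne).even_card
    rw [Finset.card_sdiff_of_subset (by grind), Finset.card_pair hxy.ne] at h1
    rw [Finset.card_sdiff_of_subset (by grind), hcard4]
    grind
  obtain ⟨T, hT, K, hK, hc⟩ := exists_isOddFamily
    (h.tight x hx y hy x' hx' y' hy' hxx' hyy' hxy hxy') heven
  have hK' : G.IsOddFamily (X ∪ Y) (T ∪ {x, y, x', y'}) K := by
    refine ⟨fun k hk a ha ↦ ?_, hK.odd, hK.disjoint, fun k hk a ha b hb hab ↦ ?_⟩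
    · have := hK.subset k hk ha
      grind
    · by_cases hb' : b ∈ (X ∪ Y) \ {x, y, x', y'}
      · have := hK.closed k hk a ha b hb' hab
        grind
      · grind
  have hTc : (T ∪ {x, y, x', y'}).card = T.card + 4 := by
    rw [Finset.card_union_of_disjoint (Finset.disjoint_left.2 (by grind)), hcard4]
  obtain ⟨T', hT'V, hTT', K', hK', hc', hcrit⟩ := hK'.exists_critical (by grind) (by omega)
  have hT'c := Finset.card_le_card hTT'
  obtain ⟨J, hJ, N, hN, hcore, hside⟩ := h.exists_core hx hy hxy hT'V (by grind) (by grind)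
    (by omega) hK' hc' hcrit
  have hJT : ∀ a ∈ J.biUnion id, a ∉ T' := by
    intro a ha
    obtain ⟨k, hk, hak⟩ := Finset.mem_biUnion.1 ha
    have := hK'.subset k (hJ hk) hak
    grind
  rcases hside with ⟨h1, h2⟩ | ⟨h1, h2⟩
  · exact Or.inl ⟨_, _, hcore.shore h.disjoint hx hy h1 h2 hy' hyy'.symm (by grind)⟩
  · right
    have hcore' : G.IsCore (Y ∪ X) y x J N := by
      rw [Finset.union_comm]
      exact ⟨hcore.nonempty, hcore.family, hcore.subset, hcore.right_mem, hcore.left_mem,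
        hcore.card_eq, hcore.delete_two⟩
    exact ⟨_, _, hcore'.shore h.disjoint.symm hy hx (by rwa [Finset.pair_comm]) h2 hx' hxx'.symm
      (by grind)⟩

end SimpleGraph

/-! ### Contraction of a shore -/

namespace SimpleGraph

variable {α : Type*} [DecidableEq α] {G : SimpleGraph α} {X Y Z P A B D : Finset α}
  {x y x' y' u v : α}

omit [DecidableEq α] in
/-- The graph obtained by contracting `Z` to the vertex `x`, where only the edges leaving `Z` from
`P` are kept. The other elements of `Z` become isolated. -/
def contract (G : SimpleGraph α) (Z P : Finset α) (x : α) : SimpleGraph α where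
  Adj a b := (a ∉ Z ∧ b ∉ Z ∧ G.Adj a b) ∨ (a = x ∧ b ≠ x ∧ b ∉ Z ∧ ∃ s ∈ P, G.Adj s b) ∨
    (b = x ∧ a ≠ x ∧ a ∉ Z ∧ ∃ s ∈ P, G.Adj s a)
  symm := ⟨fun a b h ↦ by
    rcases h with ⟨ha, hb, hab⟩ | h | h
    · exact Or.inl ⟨hb, ha, hab.symm⟩
    · exact Or.inr (Or.inr h)
    · exact Or.inr (Or.inl h)⟩
  loopless := ⟨fun a h ↦ by
    rcases h with ⟨-, -, h⟩ | ⟨h, h', -⟩ | ⟨h, h', -⟩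
    · exact h.ne rfl
    · exact h' h
    · exact h' h⟩

namespace Shore

section

variable (hs : G.Shore X Y x y Z P)
include hs

lemma contract_adj {a b : α} (ha : a ∉ Z) (hb : b ∉ Z) :
    (G.contract Z P x).Adj a b ↔ G.Adj a b := by
  have hx := hs.attach_subset hs.mem
  have : a ≠ x := by grind
  have : b ≠ x := by grind
  simp_all [contract]

lemma contract_adj_left {b : α} (hb : b ∉ Z) :
    (G.contract Z P x).Adj x b ↔ ∃ s ∈ P, G.Adj s b := by
  have hx := hs.attach_subset hs.mem
  have : b ≠ x := by grind
  simp_all [contract]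

lemma matchable_contract_iff (hA : Disjoint A Z) :
    (G.contract Z P x).Matchable A ↔ G.Matchable A := by
  have hA' := Finset.disjoint_left.1 hA
  exact ⟨fun h ↦ h.mono fun a ha b hb ↦ (hs.contract_adj (hA' ha) (hA' hb)).1,
    fun h ↦ h.mono fun a ha b hb ↦ (hs.contract_adj (hA' ha) (hA' hb)).2⟩

/-- Perfect matchings of the contraction extend over the shore. -/
lemma matchable_union_of_contract (hA : (G.contract Z P x).Matchable A) (hxA : x ∈ A)
    (hAZ : Disjoint (A.erase x) Z) : G.Matchable (A ∪ Z) := by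
  have hd := Finset.disjoint_left.1 hAZ
  have hx := hs.attach_subset hs.mem
  obtain ⟨b, hb, hxb, hm⟩ := hA.exists_partner hxA
  have hbZ : b ∉ Z := hd (by grind [hxb.ne])
  obtain ⟨s, hsP, hsb⟩ := (hs.contract_adj_left hbZ).1 hxb
  have hsZ := hs.attach_subset hsP
  rw [hs.matchable_contract_iff (Finset.disjoint_left.2 (by grind))] at hm
  refine Matchable.of_sdiff_pair (a := s) (b := b) ?_ hsb (by grind) (by grind)
  convert hm.union (hs.delete_one s hsP) (Finset.disjoint_left.2 (by grind)) using 1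
  ext c
  have := @hd c
  simp only [Finset.mem_sdiff, Finset.mem_union, Finset.mem_insert, Finset.mem_singleton,
    Finset.mem_erase] at *
  grind

end

section

variable (hs : G.Shore X Y x y Z P) (h : G.TightPair X Y)
include hs h

lemma odd_card : Odd (Z ∩ X).card := by
  have hd := Finset.disjoint_left.1 h.disjoint
  have h1 := (hs.delete_one x hs.mem).even_card
  have hx := hs.attach_subset hs.mem
  have hxX := hs.attach_left hs.mem
  have h2 : Z.erase x = (Z ∩ X).erase x ∪ Z ∩ Y := by
    have := hs.subset
    grind
  rw [h2, Finset.card_union_of_disjoint (Finset.disjoint_left.2 (by grind)), Nat.even_add,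
    Finset.card_erase_of_mem (by grind), Nat.even_sub (Finset.card_pos.2 ⟨x, by grind⟩)] at h1
  have := hs.even_card
  grind

/-- As `|Z ∩ Y|` is even and `Z ∩ Y` has no neighbour but `y` in `Y \ Z`, a perfect matching of
`Y \ {a}` does not leave `Z`. -/
lemma matchable_right {a : α} (ha : a ∈ Y) (haZ : a ∉ Z) :
    G.Matchable (Z ∩ Y) ∧ G.Matchable ((Y \ Z).erase a) := by
  have hd := Finset.disjoint_left.1 h.disjoint
  have hP := hs.attach_left
  have h1 := (h.right a ha).restrict (B := Z ∩ Y) (by grind) hs.even_card y (by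
    intro b hb c hc hcb hbc
    exact hs.closed b (by grind) (by grind) c (by grind) (by grind) hbc)
  refine ⟨h1.1, ?_⟩
  convert h1.2 using 1
  grind

/-- A perfect matching of a subset of `X` leaves `Z` only by edges with an end in `P`. -/
lemma exists_split_left (hy : y ∈ Y) (hAX : A ⊆ X) (hA : G.Matchable A) :
    ∃ U ⊆ A ∩ P, ∃ U' ⊆ A \ Z, U.card = U'.card ∧ G.Matchable ((A ∩ Z) \ U) ∧
      G.Matchable ((A \ Z) \ U') ∧ ∀ w ∈ U', ∃ u ∈ U, G.Adj u w := by
  have hd := Finset.disjoint_left.1 h.disjoint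
  rw [show A = A ∩ Z ∪ A \ Z by grind] at hA
  obtain ⟨U, hU, U', hU', hc, h1, h2, h3, h4⟩ :=
    hA.exists_split (Finset.disjoint_left.2 (by grind))
  refine ⟨U, fun u hu ↦ ?_, U', hU', hc, h1, h2, h4⟩
  obtain ⟨w, hw, huw⟩ := h3 u hu
  have hu' := hU hu
  have hw' := hU' hw
  by_contra hne
  have := hs.closed u (by grind) (by grind) w (by grind) (by grind) huw
  grind

/-- No edge of a perfect matching of `X \ {x}` leaves `Z`: by parity there would be two, and with
`x` three elements of `P` would not be matched inside `Z`. -/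
lemma matchable_left (hy : y ∈ Y) : G.Matchable (X \ Z) := by
  have hd := Finset.disjoint_left.1 h.disjoint
  have hxX := hs.attach_left hs.mem
  have hxZ := hs.attach_subset hs.mem
  obtain ⟨U, hU, U', hU', hc, h1, h2, -⟩ :=
    hs.exists_split_left h hy (Finset.erase_subset x X) (h.left x hxX)
  have hcard : (X.erase x ∩ Z).card = (Z ∩ X).card - 1 := by
    rw [← Finset.card_erase_of_mem (show x ∈ Z ∩ X by grind)]
    congr 1
    grind
  have heven := h1.even_card
  have hUX : U ⊆ X.erase x ∩ Z := by
    have := hs.attach_subset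
    grind
  have hle := Finset.card_le_card hUX
  rw [Finset.card_sdiff_of_subset hUX, hcard, Nat.even_sub (hcard ▸ hle)] at heven
  have hodd := hs.odd_card h
  have hU2 : U.card < 2 := by
    by_contra! hge
    refine hs.not_matchable (insert x U) ?_ ?_ ?_
    · have := hs.mem
      grind
    · rw [Finset.card_insert_of_notMem (by grind)]
      omega
    · convert h1.union (hs.matchable_right h hy hs.notMem).1 (Finset.disjoint_left.2 (by grind))
        using 1
      have h3 := hs.subset
      have h4 := hs.attach_left
      grind
  have hU0 : U'.card = 0 := by grind
  rw [Finset.card_eq_zero] at hU0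
  subst hU0
  convert h2 using 1
  grind

/-- Exactly one edge of a perfect matching of `X \ {r}` leaves `Z`, by parity and because three
elements of `P` cannot be deleted. -/
lemma exists_matchable_left (hy : y ∈ Y) {r : α} (hr : r ∈ X) (hrZ : r ∉ Z) :
    ∃ s ∈ P, ∃ w ∈ X \ Z, w ≠ r ∧ G.Adj s w ∧ G.Matchable ((X \ Z) \ {r, w}) := by
  have hd := Finset.disjoint_left.1 h.disjoint
  obtain ⟨U, hU, U', hU', hc, h1, h2, h3⟩ :=
    hs.exists_split_left h hy (Finset.erase_subset r X) (h.left r hr)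
  have hcard : X.erase r ∩ Z = Z ∩ X := by grind
  rw [hcard] at h1
  have heven := h1.even_card
  have hUX : U ⊆ Z ∩ X := by
    have := hs.attach_subset
    grind
  rw [Finset.card_sdiff_of_subset hUX, Nat.even_sub (Finset.card_le_card hUX)] at heven
  have hodd := hs.odd_card h
  have hU3 : U.card < 3 := by
    by_contra! hge
    refine hs.not_matchable U (by grind) hge ?_
    convert h1.union (hs.matchable_right h hy hs.notMem).1 (Finset.disjoint_left.2 (by grind))
      using 1
    have h3 := hs.subset
    have h4 := hs.attach_left
    grind
  have hU1 : U'.card = 1 := by grind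
  obtain ⟨w, rfl⟩ := Finset.card_eq_one.1 hU1
  obtain ⟨s, hsU, hsw⟩ := h3 w (by grind)
  refine ⟨s, by grind, w, by grind, by grind, hsw, ?_⟩
  convert h2 using 1
  grind

/-- Contracting a shore yields a tight pair. -/
lemma tightPair_contract (hy : y ∈ Y) (hxy : G.Adj x y) :
    (G.contract Z P x).TightPair (insert x (X \ Z)) (Y \ Z) := by
  have hd := Finset.disjoint_left.1 h.disjoint
  have hxX := hs.attach_left hs.mem
  have hxZ := hs.attach_subset hs.mem
  have hyZ := hs.notMem
  have hPX := hs.attach_left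
  have hPZ := hs.attach_subset
  have hZ := hs.subset
  refine ⟨Finset.disjoint_left.2 (by grind), ?_, ?_, ?_, ?_, ?_⟩
  · intro a ha
    by_cases hax : a = x
    · rw [hax, Finset.erase_insert (by grind),
        hs.matchable_contract_iff (Finset.disjoint_left.2 (by grind))]
      exact hs.matchable_left h hy
    · obtain ⟨s, hsP, w, hw, hwa, hsw, hm⟩ :=
        hs.exists_matchable_left h hy (r := a) (by grind) (by grind)
      have hadj := (hs.contract_adj_left (b := w) (by grind)).2 ⟨s, hsP, hsw⟩
      refine Matchable.of_sdiff_pair (a := x) (b := w) ?_ hadj (by grind) (by grind)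
      rw [hs.matchable_contract_iff (Finset.disjoint_left.2 (by grind))]
      convert hm using 1
      grind
  · intro a ha
    rw [hs.matchable_contract_iff (Finset.disjoint_left.2 (by grind))]
    exact (hs.matchable_right h (by grind) (by grind)).2
  · intro a ha
    by_cases hax : a = x
    · exact ⟨y, by grind, hax ▸ (hs.contract_adj_left hyZ).2 ⟨x, hs.mem, hxy⟩⟩
    · obtain ⟨w, hw, haw⟩ := h.exists_adj_left a (by grind)
      have hwZ : w ∉ Z := by
        intro hwZ
        have := hs.closed w hwZ (by grind) a (by grind) (by grind) haw.symm
        grind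
      exact ⟨w, by grind, (hs.contract_adj (by grind) hwZ).2 haw⟩
  · intro a ha
    obtain ⟨w, hw, haw⟩ := h.exists_adj_right a (by grind)
    by_cases hwZ : w ∈ Z
    · refine ⟨x, by grind, SimpleGraph.Adj.symm ((hs.contract_adj_left (by grind)).2 ?_)⟩
      by_cases hwP : w ∈ P
      · exact ⟨w, hwP, haw.symm⟩
      · have := hs.closed w hwZ hwP a (by grind) (by grind) haw.symm
        exact ⟨x, hs.mem, this ▸ hxy⟩
    · exact ⟨w, by grind, (hs.contract_adj (by grind) hwZ).2 haw⟩
  -- By symmetry, at most the first of the two cross edges ends in the contracted vertex.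
  · have key : ∀ a ∈ insert x (X \ Z), ∀ b ∈ Y \ Z, ∀ a' ∈ X \ Z, ∀ b' ∈ Y \ Z, a ≠ a' → b ≠ b' →
        (G.contract Z P x).Adj a b → G.Adj a' b' →
        ¬ (G.contract Z P x).Matchable ((insert x (X \ Z) ∪ Y \ Z) \ {a, b, a', b'}) := by
      intro a ha b hb a' ha' b' hb' haa hbb hab hab' hm
      by_cases hax : a = x
      · subst hax
        obtain ⟨s, hsP, hsb⟩ := (hs.contract_adj_left (by grind)).1 hab
        have hsZ := hPZ hsP
        have hsX := hPX hsP
        refine h.tight s hsX b (by grind) a' (by grind) b' (by grind) (by grind) hbb hsb hab' ?_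
        rw [hs.matchable_contract_iff (Finset.disjoint_left.2 (by grind))] at hm
        convert hm.union (hs.delete_one s hsP) (Finset.disjoint_left.2 (by grind)) using 1
        ext c
        have := @hZ c
        have := @hd c
        simp only [Finset.mem_sdiff, Finset.mem_union, Finset.mem_insert, Finset.mem_singleton,
          Finset.mem_erase] at *
        grind
      · refine h.tight a (by grind) b (by grind) a' (by grind) b' (by grind) haa hbb
          ((hs.contract_adj (by grind) (by grind)).1 hab) hab' ?_
        have h1 := hs.matchable_union_of_contract hm (by grind) (Finset.disjoint_left.2 (by grind))
        convert h1 using 1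
        ext c
        have := @hZ c
        simp only [Finset.mem_sdiff, Finset.mem_union, Finset.mem_insert, Finset.mem_singleton] at *
        grind
    intro a ha b hb a' ha' b' hb' haa hbb hab hab' hm
    by_cases hax : a' = x
    · refine key a' ha' b' hb' a (by grind) b hb haa.symm hbb.symm hab'
        ((hs.contract_adj (by grind) (by grind)).1 hab) ?_
      convert hm using 2
      grind
    · exact key a ha b hb a' (by grind) b' hb' haa hbb hab
        ((hs.contract_adj (by grind) (by grind)).1 hab') hm

end

end Shore

end SimpleGraph

/-! ### Leaves of tight pairs -/

namespace SimpleGraph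

variable {α : Type*} [DecidableEq α] {G : SimpleGraph α} {X Y Z P A B D : Finset α}
  {x y x' y' u v : α}

/-- `D` is a nonempty set on one side of a tight pair, avoiding the ends of the cross edge `xy`,
whose neighbours outside `D` are among `u ∈ X` and `v ∈ Y`. -/
structure IsLeaf (G : SimpleGraph α) (X Y : Finset α) (x y : α) (D : Finset α) (u v : α) :
    Prop where
  nonempty : D.Nonempty
  side : D ⊆ X.erase x ∨ D ⊆ Y.erase y
  left_mem : u ∈ X
  right_mem : v ∈ Y
  left_notMem : u ∉ D
  right_notMem : v ∉ D
  closed : ∀ d ∈ D, ∀ w ∈ X ∪ Y, G.Adj d w → w ∈ D ∨ w = u ∨ w = v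

lemma IsLeaf.symm (h : G.IsLeaf X Y x y D u v) : G.IsLeaf Y X y x D v u where
  nonempty := h.nonempty
  side := h.side.symm
  left_mem := h.right_mem
  right_mem := h.left_mem
  left_notMem := h.right_notMem
  right_notMem := h.left_notMem
  closed d hd w hw hdw := by
    have := h.closed d hd w (by grind) hdw
    tauto

/-- Let `D` be matchable and let every vertex of `D` have a neighbour in `P`. If deleting the ends
in `D` of two disjoint edges between `D` and `P` never leaves a matchable set, then adjacent
vertices of `D` have the same unique neighbour in `P`, so that the vertices with a given neighbour
in `P` are closed under adjacency in `D`. -/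
lemma Matchable.exists_uniform_subset (hDm : G.Matchable D) (hne : D.Nonempty)
    (hnbr : ∀ d ∈ D, ∃ s ∈ P, G.Adj d s)
    (hcontra : ∀ s ∈ P, ∀ t ∈ P, ∀ d ∈ D, ∀ e ∈ D, s ≠ t → d ≠ e → G.Adj d s → G.Adj e t →
      ¬ G.Matchable (D \ {d, e})) :
    ∃ D' ⊆ D, D'.Nonempty ∧ ∃ s ∈ P, ∀ d ∈ D', ∀ w, G.Adj d w →
      (w ∈ D → w ∈ D') ∧ (w ∈ P → w = s) := by
  classical
  have hsame : ∀ d ∈ D, ∀ e ∈ D, d ≠ e → G.Matchable (D \ {d, e}) → ∀ s ∈ P, ∀ t ∈ P,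
      G.Adj d s → G.Adj e t → s = t := by
    intro d hdD e heD hde hm s hsP t htP hds het
    by_contra hst
    exact hcontra s hsP t htP d hdD e heD hst hde hds het hm
  clear hcontra
  have huniq : ∀ d ∈ D, ∀ s ∈ P, ∀ t ∈ P, G.Adj d s → G.Adj d t → s = t := by
    intro d hdD s hsP t htP hds hdt
    obtain ⟨e, heD, hde, hm⟩ := hDm.exists_partner hdD
    obtain ⟨r, hrP, her⟩ := hnbr e heD
    rw [hsame d hdD e heD hde.ne hm s hsP r hrP hds her,
      hsame d hdD e heD hde.ne hm t htP r hrP hdt her]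
  obtain ⟨d₀, hd₀⟩ := hne
  obtain ⟨s₀, hs₀, hds₀⟩ := hnbr d₀ hd₀
  -- The vertices of `D` adjacent to `s₀` are closed under adjacency in `D`.
  refine ⟨D.filter fun d ↦ G.Adj d s₀, Finset.filter_subset _ _,
    ⟨d₀, Finset.mem_filter.2 ⟨hd₀, hds₀⟩⟩, s₀, hs₀, ?_⟩
  intro d hdD' w hdw
  obtain ⟨hdD, hds⟩ := Finset.mem_filter.1 hdD'
  refine ⟨fun hwD ↦ Finset.mem_filter.2 ⟨hwD, ?_⟩, fun hwP ↦ huniq d hdD w hwP s₀ hs₀ hdw hds⟩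
  obtain ⟨s₁, hs₁, hws₁⟩ := hnbr w hwD
  obtain ⟨d', hd'D, hdd', hm⟩ := hDm.exists_partner hdD
  obtain ⟨s₂, hs₂, hds₂⟩ := hnbr d' hd'D
  have h1 := hsame d hdD d' hd'D hdd'.ne hm s₀ hs₀ s₂ hs₂ hds hds₂
  by_cases hwd' : w = d'
  · exact hwd' ▸ h1 ▸ hds₂
  -- Exchanging the matching edges `dd'`, `ww'` for `dw` leaves out `d'` and `w'`.
  obtain ⟨w', hw', hww', hm'⟩ := hm.exists_partner (a := w)
    (by simp [hwD, hdw.ne', hwd'])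
  obtain ⟨hw'D, hw'd⟩ := Finset.mem_sdiff.1 hw'
  simp only [Finset.mem_insert, Finset.mem_singleton, not_or] at hw'd
  obtain ⟨s₃, hs₃, hws₃⟩ := hnbr w' hw'D
  have hdw' := hdw.ne
  have hww'' := hww'.ne
  have hdd'' := hdd'.ne
  have hmw : G.Matchable (D \ {w, w'}) := by
    clear hsame huniq hnbr
    refine Matchable.of_sdiff_pair (a := d) (b := d') ?_ hdd' (by grind) (by grind)
    convert hm' using 1
    grind
  have h2 := hsame w hwD w' hw'D hww'.ne hmw s₁ hs₁ s₃ hs₃ hws₁ hws₃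
  have hmd : G.Matchable (D \ {d', w'}) := by
    clear hsame huniq hnbr
    refine Matchable.of_sdiff_pair (a := d) (b := w) ?_ hdw (by grind) (by grind)
    convert hm' using 1
    grind
  have h3 := hsame d' hd'D w' hw'D (Ne.symm hw'd.2) hmd s₂ hs₂ s₃ hs₃ hds₂ hws₃
  rw [h1, h3, ← h2]
  exact hws₁

namespace Shore

variable (hs : G.Shore X Y x y Z P) (h : G.TightPair X Y)
include hs h

/-- If `D ⊆ Y` is attached only to `v ∈ Y` and to `P`, then it splits according to the unique
neighbour in `P`: two disjoint edges between `D` and `P` whose deletion leaves `D` matchable would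
both be cross edges of one perfect matching. -/
lemma exists_leaf_of_subset_right (hy : y ∈ Y) (hD : D ⊆ (Y \ Z).erase y) (hne : D.Nonempty)
    (hv : v ∈ Y \ Z) (hvD : v ∉ D)
    (hDP : ∀ d ∈ D, ∀ w ∈ X ∪ Y, G.Adj d w → w ∈ D ∨ w ∈ P ∨ w = v) :
    ∃ D u v, G.IsLeaf X Y x y D u v := by
  classical
  have hd := Finset.disjoint_left.1 h.disjoint
  have hPX := hs.attach_left
  have hPZ := hs.attach_subset
  have hZ := hs.subset
  have hYv : ∀ d ∈ D, ∀ w ∈ Y, w ∉ D → G.Adj d w → w = v := by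
    intro d hdD w hw hwD hdw
    have := hDP d hdD w (by grind) hdw
    grind
  have hDm : G.Matchable D := ((h.right v (by grind)).restrict_of_closed (B := D) (by grind)
    (by
      intro d hdD w hw hwD hdw
      have := hYv d hdD w (by grind) hwD hdw
      grind)).1
  have hrest : G.Matchable ((Y \ Z).erase y \ D) :=
    ((hs.matchable_right h hy hs.notMem).2.restrict hD hDm.even_card v
      (fun d hdD w hw ↦ hYv d hdD w (by grind))).2
  have hleft := hs.matchable_left h hy
  have hcontra : ∀ s ∈ P, ∀ t ∈ P, ∀ d ∈ D, ∀ e ∈ D, s ≠ t → d ≠ e → G.Adj d s → G.Adj e t →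
      ¬ G.Matchable (D \ {d, e}) := by
    intro s hsP t htP d hdD e heD hst hde hds het hm
    have hDY : ∀ c ∈ D, c ∈ Y ∧ c ∉ Z ∧ c ≠ y := by grind
    have hsX := hPX hsP
    have htX := hPX htP
    have hsZ := hPZ hsP
    have htZ := hPZ htP
    have hyZ := hs.notMem
    refine h.tight s hsX d (by grind) t htX e (by grind) hst hde hds.symm het.symm ?_
    have h1 := hm.union hrest (Finset.disjoint_left.2 (by grind))
    have h2 := h1.union (hs.delete_two s hsP t htP hst) (Finset.disjoint_left.2 (by grind))
    convert h2.union hleft (Finset.disjoint_left.2 (by grind)) using 1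
    ext c
    have := @hZ c
    have := @hd c
    have := hDY c
    simp only [Finset.mem_sdiff, Finset.mem_union, Finset.mem_insert, Finset.mem_singleton,
      Finset.mem_erase] at *
    grind
  have hnbr : ∀ d ∈ D, ∃ s ∈ P, G.Adj d s := by
    intro d hdD
    obtain ⟨s, hsX, hds⟩ := h.exists_adj_right d (by grind)
    have := hDP d hdD s (by grind) hds
    exact ⟨s, by grind, hds⟩
  obtain ⟨D', hD', hne', s, hsP, hcl⟩ := hDm.exists_uniform_subset hne hnbr hcontra
  refine ⟨D', s, v, hne', Or.inr (by grind), hPX hsP, by grind, by grind, by grind, ?_⟩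
  intro d hdD' w hw hdw
  have h1 := hcl d hdD' w hdw
  rcases hDP d (hD' hdD') w hw hdw with h2 | h2 | h2
  · exact Or.inl (h1.1 h2)
  · exact Or.inr (Or.inl (h1.2 h2))
  · exact Or.inr (Or.inr h2)

/-- If `D ⊆ X \ Z` is attached only to `P` and to `v ∈ Y`, then no edge of a perfect matching of
`X \ Z` leaves `D`. -/
lemma matchable_of_subset_left (hy : y ∈ Y) (hD : D ⊆ X \ Z) (hv : v ∈ Y)
    (hDP : ∀ d ∈ D, ∀ w ∈ X ∪ Y, G.Adj d w → w ∈ D ∨ w ∈ P ∨ w = v) : G.Matchable D := by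
  have hd := Finset.disjoint_left.1 h.disjoint
  have hPZ := hs.attach_subset
  refine ((hs.matchable_left h hy).restrict_of_closed hD ?_).1
  intro d hdD w hw hwD hdw
  have := hDP d hdD w (by grind) hdw
  grind

/-- If `D ⊆ X` is attached only to `v ∈ Y`, distinct from `y`, and to `P`, then it has a single
neighbour in `P`: otherwise there is a perfect matching with a cross edge between `D` and `v`, and
another one within `Z ∪ {y}`. -/
lemma exists_leaf_of_subset_left (hy : y ∈ Y) (hxy : G.Adj x y) (hD : D ⊆ X \ Z) (hne : D.Nonempty)
    (hv : v ∈ Y \ Z) (hvy : v ≠ y)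
    (hDP : ∀ d ∈ D, ∀ w ∈ X ∪ Y, G.Adj d w → w ∈ D ∨ w ∈ P ∨ w = v) :
    ∃ D u v, G.IsLeaf X Y x y D u v := by
  have hd := Finset.disjoint_left.1 h.disjoint
  have hPX := hs.attach_left
  have hPZ := hs.attach_subset
  have hZ := hs.subset
  have hyZ := hs.notMem
  have hxZ := hPZ hs.mem
  have hDX : ∀ c ∈ D, c ∈ X ∧ c ∉ Z ∧ c ∉ Y := by grind
  have hDm := hs.matchable_of_subset_left h hy hD (by grind) hDP
  have hDv : ∀ d ∈ D, G.Adj d v := by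
    intro d hdD
    obtain ⟨w, hw, hdw⟩ := h.exists_adj_left d (by grind)
    have := hDP d hdD w (by grind) hdw
    grind
  have h1 := (hs.tightPair_contract h hy hxy).delete_two (u := y) (v := v) (by grind) (by grind)
    hvy.symm
  have h2 := (h1.restrict (B := D) (by grind) hDm.even_card x (by
    intro d hdD w hw hwD hdw
    by_contra hwx
    have hwZ : w ∉ Z := by grind
    have := hDP d hdD w (by grind) ((hs.contract_adj (by grind) hwZ).1 hdw)
    grind)).2
  obtain ⟨b, hb, hxb, hm⟩ := h2.exists_partner (a := x) (by grind)
  have hbx := hxb.ne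
  have hbZ : b ∉ Z := by grind
  obtain ⟨s, hsP, hsb⟩ := (hs.contract_adj_left hbZ).1 hxb
  rw [hs.matchable_contract_iff (Finset.disjoint_left.2 (by grind))] at hm
  have hsZ := hPZ hsP
  have hsX := hPX hsP
  refine ⟨D, s, v, hne, Or.inl (by grind), hsX, by grind, by grind, by grind, ?_⟩
  intro d hdD w hw hdw
  rcases hDP d hdD w hw hdw with h3 | hwP | h3
  · exact Or.inl h3
  · right
    left
    by_contra hws
    have hwZ := hPZ hwP
    have hwX := hPX hwP
    obtain ⟨e, heD, hde, hDe⟩ := hDm.exists_partner hdD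
    have hde' := hde.ne
    have hodd : Odd ((insert y Z \ {w, s}) ∩ X).card := by
      have h4 : (insert y Z \ {w, s}) ∩ X = (Z ∩ X) \ {w, s} := by grind
      have h5 := hs.odd_card h
      have h6 : ({w, s} : Finset α) ⊆ Z ∩ X := by grind
      have h7 := Finset.card_le_card h6
      rw [Finset.card_pair hws] at h7
      rw [h4, Finset.card_sdiff_of_subset h6, Finset.card_pair hws]
      grind
    refine h.not_matchable_of_odd (x := e) (y := v) (by grind) (by grind) (hDv e heD) ?_ hodd
      (hs.delete_two w hwP s hsP hws) ?_
    · grind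
    · refine Matchable.of_sdiff_pair (a := w) (b := d) ?_ hdw.symm (by grind) (by grind)
      refine Matchable.of_sdiff_pair (a := s) (b := b) ?_ hsb (by grind) (by grind)
      convert hDe.union hm (Finset.disjoint_left.2 (by grind)) using 1
      have hb' : b ∈ X ∪ Y ∧ b ∉ D ∧ b ≠ y ∧ b ≠ v := by grind
      ext c
      have := @hZ c
      have := hDX c
      simp only [Finset.mem_sdiff, Finset.mem_union, Finset.mem_insert, Finset.mem_singleton] at *
      grind
  · exact Or.inr (Or.inr h3)

/-- A set `D ⊆ X` attached only to `P` and `y` can be added to the shore. -/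
lemma union (hy : y ∈ Y) (hD : D ⊆ X \ Z)
    (hDP : ∀ d ∈ D, ∀ w ∈ X ∪ Y, G.Adj d w → w ∈ D ∨ w ∈ P ∨ w = y) :
    G.Shore X Y x y (Z ∪ D) P := by
  have hd := Finset.disjoint_left.1 h.disjoint
  have hPX := hs.attach_left
  have hPZ := hs.attach_subset
  have hZ := hs.subset
  have hyZ := hs.notMem
  have hDX : ∀ c ∈ D, c ∈ X ∧ c ∉ Z ∧ c ∉ Y := by grind
  have hDm := hs.matchable_of_subset_left h hy hD hy hDP
  refine ⟨by grind, by grind, by grind, hPX, hs.mem, ?_, ?_, ?_, ?_, ?_, ?_, ?_⟩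
  · exact hs.one_lt_card.trans_le (Finset.card_le_card Finset.subset_union_left)
  · convert hs.even_card using 2
    grind
  · intro a ha haP r hr hrZ har
    by_cases haZ : a ∈ Z
    · exact hs.closed a haZ haP r hr (by grind) har
    · have := hDP a (by grind) r hr har
      grind
  · intro s hsP
    convert (hs.delete_one s hsP).union hDm (Finset.disjoint_left.2 (by grind)) using 1
    have := hPZ hsP
    grind
  · intro s hsP t htP hst
    have := hPZ hsP
    have := hPZ htP
    convert (hs.delete_two s hsP t htP hst).union hDm (Finset.disjoint_left.2 (by grind)) using 1
    grind
  · intro U hU hU3 hm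
    rw [show (Z ∪ D) \ U = Z \ U ∪ D by grind] at hm
    obtain ⟨W, hW, W', hW', -, h1, -, h2, -⟩ := hm.exists_split (Finset.disjoint_left.2 (by grind))
    refine hs.not_matchable (U ∪ W) ?_ (hU3.trans (Finset.card_le_card Finset.subset_union_left)) ?_
    · intro c hc
      rcases Finset.mem_union.1 hc with hc | hc
      · exact hU hc
      · obtain ⟨d, hdW, hcd⟩ := h2 c hc
        have hcZ := hW hc
        have := hDP d (hW' hdW) c (by grind) hcd.symm
        grind
    · convert h1 using 1
      grind
  · obtain ⟨r, hr, hrZ, hry⟩ := hs.rest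
    exact ⟨r, hr, by grind, hry⟩

end Shore

/-- Leaves of smaller tight pairs yield leaves of a tight pair with a shore `Z`. Let `D` be a leaf
of the contraction of `Z`, attached to `u` and `v`. If `u ≠ x`, it is a leaf of the given pair.
Otherwise `D` is attached to `v` and a subset of `P`, and either a leaf is contained in `D`, or `D`
is on the side of `x` and attached to `y`. In the last case `Z ∪ D` is a larger shore, whence the
induction on the number of vertices outside `Z`. -/
lemma Shore.exists_leaf (hs : G.Shore X Y x y Z P) (h : G.TightPair X Y) (hy : y ∈ Y)
    (hxy : G.Adj x y)
    (ih : ∀ (G' : SimpleGraph α) (X' Y' : Finset α), (X' ∪ Y').card < (X ∪ Y).card →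
      G'.TightPair X' Y' → x ∈ X' → y ∈ Y' → G'.Adj x y → 2 < (X' ∪ Y').card →
      ∃ D u v, G'.IsLeaf X' Y' x y D u v) :
    ∃ D u v, G.IsLeaf X Y x y D u v := by
  induction hn : ((X ∪ Y) \ Z).card using Nat.strong_induction_on generalizing Z with
  | _ n ihn =>
    have hd := Finset.disjoint_left.1 h.disjoint
    have hPX := hs.attach_left
    have hPZ := hs.attach_subset
    have hZ := hs.subset
    have hyZ := hs.notMem
    have hxZ := hPZ hs.mem
    have hxX := hPX hs.mem
    have hcard : (insert x (X \ Z) ∪ Y \ Z).card < (X ∪ Y).card := by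
      obtain ⟨z, hz, hzx⟩ := Finset.exists_mem_ne hs.one_lt_card x
      exact Finset.card_lt_card (Finset.ssubset_iff_of_subset (by grind) |>.2 ⟨z, by grind⟩)
    have hcard' : 2 < (insert x (X \ Z) ∪ Y \ Z).card := by
      obtain ⟨r, hr, hrZ, hry⟩ := hs.rest
      exact Finset.two_lt_card.2 ⟨x, by grind, y, by grind, r, by grind, by grind⟩
    obtain ⟨D, u, v, hD⟩ := ih _ _ _ hcard (hs.tightPair_contract h hy hxy) (by grind) (by grind)
      ((hs.contract_adj_left hyZ).2 ⟨x, hs.mem, hxy⟩) hcard'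
    have hv := hD.right_mem
    have hu := hD.left_mem
    have huD := hD.left_notMem
    have hvD := hD.right_notMem
    have hside : D ⊆ X \ Z ∨ D ⊆ (Y \ Z).erase y := by
      refine hD.side.imp_left fun hDX c hc ↦ ?_
      have := hDX hc
      grind
    have hDZ : ∀ d ∈ D, d ∈ X ∪ Y ∧ d ∉ Z ∧ d ≠ y := by
      intro d hdD
      rcases hside with hside | hside <;> have := hside hdD <;> grind
    have hDout : ∀ d ∈ D, ∀ w ∈ X ∪ Y, w ∉ Z → G.Adj d w → w ∈ D ∨ w = u ∨ w = v :=
      fun d hdD w hw hwZ hdw ↦ hD.closed d hdD w (by grind)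
        ((hs.contract_adj (hDZ d hdD).2.1 hwZ).2 hdw)
    have hDin : ∀ d ∈ D, ∀ w ∈ Z, G.Adj d w → w ∈ P ∧ u = x := by
      intro d hdD w hwZ hdw
      have hwP : w ∈ P := by
        by_contra hwP
        exact (hDZ d hdD).2.2 (hs.closed w hwZ hwP d (hDZ d hdD).1 (hDZ d hdD).2.1 hdw.symm)
      refine ⟨hwP, ?_⟩
      have := hD.closed d hdD x (by grind)
        ((hs.contract_adj_left (hDZ d hdD).2.1).2 ⟨w, hwP, hdw.symm⟩).symm
      have := hDZ x
      grind
    by_cases hux : u = x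
    · have hDP : ∀ d ∈ D, ∀ w ∈ X ∪ Y, G.Adj d w → w ∈ D ∨ w ∈ P ∨ w = v := by
        intro d hdD w hw hdw
        by_cases hwZ : w ∈ Z
        · exact Or.inr (Or.inl (hDin d hdD w hwZ hdw).1)
        · have := hDout d hdD w hw hwZ hdw
          grind
      rcases hside with hDX | hDY
      · by_cases hvy : v = y
        · subst hvy
          obtain ⟨d, hdD⟩ := hD.nonempty
          refine ihn _ ?_ (hs.union h hy hDX hDP) rfl
          rw [← hn]
          have := hDZ d hdD
          exact Finset.card_lt_card (Finset.ssubset_iff_of_subset (by grind) |>.2 ⟨d, by grind⟩)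
        · exact hs.exists_leaf_of_subset_left h hy hxy hDX hD.nonempty hv hvy hDP
      · exact hs.exists_leaf_of_subset_right h hy hDY hD.nonempty hv hvD hDP
    · refine ⟨D, u, v, hD.nonempty, ?_, by grind, by grind, huD, hvD, ?_⟩
      · exact hside.imp (fun hDX c hc ↦ by have := hDX hc; grind) fun hDY c hc ↦ by
          have := hDY hc; grind
      · intro d hdD w hw hdw
        by_cases hwZ : w ∈ Z
        · exact absurd (hDin d hdD w hwZ hdw).2 hux
        · exact hDout d hdD w hw hwZ hdw

/-- A tight pair with more than two vertices has a leaf: if the cross edges do not all meet `xy`,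
contract a shore. Otherwise all of `X` or `Y`, without the end of `xy`, is a leaf. -/
theorem TightPair.exists_leaf (h : G.TightPair X Y) (hx : x ∈ X) (hy : y ∈ Y) (hxy : G.Adj x y)
    (hcard : 2 < (X ∪ Y).card) : ∃ D u v, G.IsLeaf X Y x y D u v := by
  induction hn : (X ∪ Y).card using Nat.strong_induction_on generalizing G X Y x y with
  | _ n ih =>
    subst hn
    have hd := Finset.disjoint_left.1 h.disjoint
    by_cases hex : ∃ x' ∈ X, ∃ y' ∈ Y, x ≠ x' ∧ y ≠ y' ∧ G.Adj x' y'
    · obtain ⟨x', hx', y', hy', hxx', hyy', hxy'⟩ := hex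
      rcases h.exists_shore hx hy hx' hy' hxx' hyy' hxy hxy' with ⟨Z, P, hs⟩ | ⟨Z, P, hs⟩
      · exact hs.exists_leaf h hy hxy fun G' X' Y' hlt h' hx hy hxy hc ↦
          ih _ hlt h' hx hy hxy hc rfl
      · obtain ⟨D, u, v, hD⟩ := hs.exists_leaf h.symm hx hxy.symm fun G' X' Y' hlt h' hy hx hxy hc ↦
          ih _ (by rwa [Finset.union_comm X Y]) h' hy hx hxy hc rfl
        exact ⟨D, v, u, hD.symm⟩
    · clear ih
      push Not at hex
      rcases (Y.erase y).eq_empty_or_nonempty with hY | hY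
      · refine ⟨X.erase x, x, y, ?_, Or.inl subset_rfl, hx, hy, by grind, by grind, ?_⟩
        · -- Otherwise `X = {x}` and `Y = {y}`.
          by_contra! hX
          have hX' := Finset.insert_erase hx
          have hY' := Finset.insert_erase hy
          rw [hX] at hX'
          rw [hY] at hY'
          rw [← hX', ← hY'] at hcard
          have h1 := Finset.card_union_le {x} {y}
          simp only [insert_empty_eq, Finset.card_singleton] at h1 hcard
          omega
        · grind
      · refine ⟨Y.erase y, x, y, hY, Or.inr subset_rfl, hx, hy, by grind, by grind, ?_⟩
        intro d hdY w hw hdw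
        by_contra! hne
        exact hex w (by grind) d (by grind) (by grind) (by grind) hdw.symm

end SimpleGraph

/-! ### The cut of related pairs -/

namespace SimpleGraph

variable {α : Type*} {G : SimpleGraph α}

lemma Reachable.of_closed {p : α → Prop} (hp : ∀ a b, G.Adj a b → p a → p b) {a b : α}
    (h : G.Reachable a b) (ha : p a) : p b := by
  obtain ⟨w⟩ := h
  induction w with
  | nil => exact ha
  | cons hadj _ ih => exact ih (hp _ _ hadj ha)

/-- Suppose `V` is not matchable, but becomes so on deleting the ends of any pair related by `r`. If
`r` covers `V`, then `V` is a union of two odd sets without edges between them, and related pairs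
are separated. This is the Gallai–Edmonds structure of `V`, with empty Tutte set. -/
lemma exists_cut [DecidableEq α] {V : Finset α} {r : α → α → Prop} (hne : V.Nonempty)
    (hrV : ∀ v ∈ V, ∃ w, r v w) (hr : ∀ x y, r x y → x ∈ V ∧ y ∈ V ∧ x ≠ y)
    (hm : ∀ x y, r x y → G.Matchable (V \ {x, y})) (hV : ¬ G.Matchable V) :
    ∃ X Y, Disjoint X Y ∧ X ∪ Y = V ∧
      (∀ x y, r x y → x ∈ X ∧ y ∈ Y ∨ x ∈ Y ∧ y ∈ X) ∧ ∀ a ∈ X, ∀ b ∈ Y, ¬ G.Adj a b := by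
  have heven : Even V.card := by
    obtain ⟨v, hv⟩ := hne
    obtain ⟨w, hvw⟩ := hrV v hv
    obtain ⟨-, hw, hne⟩ := hr v w hvw
    have h1 := (hm v w hvw).even_card
    have h2 : ({v, w} : Finset α) ⊆ V := by grind
    have h3 := Finset.card_le_card h2
    rw [Finset.card_sdiff_of_subset h2, Nat.even_sub h3, Finset.card_pair hne] at h1
    exact h1.2 even_two
  obtain ⟨T, hTV, K, hK, hc⟩ := exists_isOddFamily hV heven
  -- Deleting two vertices related by `r` leaves a matchable set, so it destroys the excess of
  -- `|K|` over `|T|`; this requires that both vertices lie in members of `K`, two different ones.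
  have hle : ∀ x, (K.filter (x ∈ ·)).card ≤ 1 := by
    intro x
    rw [Finset.card_le_one]
    intro k hk l hl
    by_contra hkl
    exact (Finset.disjoint_left.1 (hK.disjoint k (by grind) l (by grind) hkl))
      (show x ∈ k by grind) (by grind)
  have hT : ∀ x ∈ T, K.filter (x ∈ ·) = ∅ := by
    intro x hx
    rw [Finset.filter_eq_empty_iff]
    intro k hk hxk
    have := hK.subset k hk hxk
    grind
  have hcount : ∀ x y, r x y →
      K.card ≤ (K.filter (x ∈ ·) ∪ K.filter (y ∈ ·)).card + (T \ {x, y}).card := by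
    intro x y hxy
    have hfam : G.IsOddFamily (V \ {x, y}) T (K.filter fun k ↦ x ∉ k ∧ y ∉ k) := by
      refine ⟨fun k hk a ha ↦ ?_, fun k hk ↦ hK.odd k (by grind),
        fun k hk l hl ↦ hK.disjoint k (by grind) l (by grind),
        fun k hk a ha b hb hab ↦ hK.closed k (by grind) a ha b (by grind) hab⟩
      have := hK.subset k (by grind) ha
      grind
    have h1 := (hm x y hxy).card_le hfam
    have h2 : T ∩ (V \ {x, y}) ⊆ T \ {x, y} := by grind
    have h3 : K ⊆ (K.filter (x ∈ ·) ∪ K.filter (y ∈ ·)) ∪ K.filter fun k ↦ x ∉ k ∧ y ∉ k := by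
      grind
    have h4 := (Finset.card_le_card h3).trans (Finset.card_union_le _ _)
    have h5 := Finset.card_le_card h2
    omega
  have hT0 : T = ∅ := by
    by_contra! hne
    obtain ⟨x, hx⟩ := hne
    obtain ⟨y, hxy⟩ := hrV x (hTV hx)
    have h1 := hcount x y hxy
    rw [hT x hx, Finset.empty_union] at h1
    have h2 := hle y
    have h3 : T \ {x, y} ⊆ T.erase x := by grind
    have h4 := Finset.card_le_card h3
    rw [Finset.card_erase_of_mem hx] at h4
    omega
  subst hT0
  simp only [Finset.empty_sdiff, Finset.card_empty, add_zero, zero_add] at hcount hc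
  have hsep : ∀ x y, r x y → K.card = 2 ∧ ∃ k ∈ K, ∃ l ∈ K, k ≠ l ∧ x ∈ k ∧ y ∈ l := by
    intro x y hxy
    have h1 := hcount x y hxy
    have h2 := Finset.card_union_le (K.filter (x ∈ ·)) (K.filter (y ∈ ·))
    have hx := hle x
    have hy := hle y
    obtain ⟨k, hk⟩ := Finset.card_eq_one.1 (show (K.filter (x ∈ ·)).card = 1 by omega)
    obtain ⟨l, hl⟩ := Finset.card_eq_one.1 (show (K.filter (y ∈ ·)).card = 1 by omega)
    have hk' : k ∈ K.filter (x ∈ ·) := by simp [hk]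
    have hl' : l ∈ K.filter (y ∈ ·) := by simp [hl]
    refine ⟨by omega, k, (Finset.mem_filter.1 hk').1, l, (Finset.mem_filter.1 hl').1, ?_,
      (Finset.mem_filter.1 hk').2, (Finset.mem_filter.1 hl').2⟩
    rintro rfl
    rw [hk, hl, Finset.union_self, Finset.card_singleton] at h1
    omega
  obtain ⟨v, hv⟩ := hne
  obtain ⟨w, hvw⟩ := hrV v hv
  obtain ⟨X, Y, hXY, hKXY⟩ := Finset.card_eq_two.1 (hsep v w hvw).1
  have hXK : X ∈ K := by simp [hKXY]
  have hYK : Y ∈ K := by simp [hKXY]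
  have hd := hK.disjoint X hXK Y hYK hXY
  have hXV := hK.subset X hXK
  have hYV := hK.subset Y hYK
  refine ⟨X, Y, hd, ?_, ?_, ?_⟩
  · refine Finset.Subset.antisymm (by grind) fun x hx ↦ ?_
    obtain ⟨y, hxy⟩ := hrV x hx
    obtain ⟨-, k, hk, l, hl, hkl, hxk, hyl⟩ := hsep x y hxy
    grind
  · intro x y hxy
    obtain ⟨-, k, hk, l, hl, hkl, hxk, hyl⟩ := hsep x y hxy
    grind
  · intro a ha b hb hab
    have h1 := hK.closed X hXK a ha b (by grind) hab
    have h2 := Finset.disjoint_left.1 hd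
    grind

end SimpleGraph

/-! ### W-state graphs -/

namespace Graph

variable {α β : Type*} {G : Graph α β} [G.Loopless] {F M : Set β} {A : Finset α}

/-- The simple graph on `α` whose edges are the pairs joined by an edge of `G` in `F`. -/
def simpleGraphOn (G : Graph α β) [G.Loopless] (F : Set β) : SimpleGraph α where
  Adj a b := ∃ e ∈ F, G.IsLink e a b
  symm := ⟨fun _ _ ⟨e, he, h⟩ ↦ ⟨e, he, h.symm⟩⟩
  loopless := ⟨fun _ ⟨_, _, h⟩ ↦ h.ne rfl⟩

/-- Matchable sets have perfect matchings consisting of edges of the multigraph. -/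
lemma exists_matching_of_matchable [DecidableEq α] (h : (G.simpleGraphOn F).Matchable A) :
    ∃ M ⊆ F, (∀ e ∈ M, ∀ a, G.Inc e a → a ∈ A) ∧ M ⊆ E(G) ∧
      ∀ a ∈ A, ∃! e, e ∈ M ∧ G.Inc e a := by
  induction hn : A.card using Nat.strong_induction_on generalizing A with
  | _ n ih =>
    rcases A.eq_empty_or_nonempty with rfl | ⟨a, ha⟩
    · exact ⟨∅, by simp⟩
    · obtain ⟨b, hb, ⟨e, heF, he⟩, hm⟩ := h.exists_partner ha
      have hlt : (A \ {a, b}).card < n := by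
        rw [← hn]
        exact Finset.card_lt_card (Finset.ssubset_iff_of_subset (by grind) |>.2 ⟨a, by grind⟩)
      obtain ⟨M, hMF, hMA, hME, hM⟩ := ih _ hlt hm rfl
      have heab : ∀ x, G.Inc e x → x = a ∨ x = b := fun x hx ↦ hx.eq_or_eq_of_isLink he
      refine ⟨insert e M, Set.insert_subset heF hMF, ?_, Set.insert_subset he.edge_mem hME, ?_⟩
      · rintro f (rfl | hf) x hx
        · rcases heab x hx with rfl | rfl <;> assumption
        · have := hMA f hf x hx
          grind
      · intro x hx
        by_cases hxab : x = a ∨ x = b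
        · refine ⟨e, ⟨Or.inl rfl, ?_⟩, ?_⟩
          · rcases hxab with rfl | rfl
            · exact he.inc_left
            · exact he.inc_right
          · rintro f ⟨rfl | hf, hfx⟩
            · rfl
            · have := hMA f hf x hfx
              grind
        · obtain ⟨f, ⟨hf, hfx⟩, hfu⟩ := hM x (by grind)
          refine ⟨f, ⟨Or.inr hf, hfx⟩, ?_⟩
          rintro g ⟨rfl | hg, hgx⟩
          · exact absurd (heab x hgx) hxab
          · exact hfu g ⟨hg, hgx⟩

/-- If a perfect matching of `G` matches `A` within itself, by edges in `F`, then `A` is matchable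
by edges in `F`. -/
lemma IsPerfectMatching.matchable (hM : G.IsPerfectMatching M) (hAV : ∀ a ∈ A, a ∈ V(G))
    (hA : ∀ a ∈ A, ∀ e ∈ M, ∀ b, G.IsLink e a b → e ∈ F ∧ b ∈ A) :
    (G.simpleGraphOn F).Matchable A := by
  have hex : ∀ a, ∃ b, a ∈ V(G) → ∃ e ∈ M, G.IsLink e a b := by
    intro a
    by_cases ha : a ∈ V(G)
    · obtain ⟨e, ⟨he, b, heb⟩, -⟩ := hM.existsUnique a ha
      exact ⟨b, fun _ ↦ ⟨e, he, heb⟩⟩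
    · exact ⟨a, fun h ↦ absurd h ha⟩
  choose m hm using hex
  refine ⟨m, fun a ha ↦ ?_⟩
  obtain ⟨e, he, hea⟩ := hm a (hAV a ha)
  obtain ⟨heF, hmA⟩ := hA a ha e he _ hea
  obtain ⟨f, hf, hfm⟩ := hm (m a) (hAV _ hmA)
  have hef : f = e :=
    (hM.existsUnique (m a) (hAV _ hmA)).unique ⟨hf, hfm.inc_left⟩ ⟨he, hea.inc_right⟩
  subst hef
  exact ⟨hmA, ⟨f, heF, hea⟩, hfm.right_unique hea.symm⟩

namespace HalfEdgeColouring

variable {c : G.HalfEdgeColouring}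

omit [G.Loopless] in
lemma monochromaticEdges_subset : c.monochromaticEdges ⊆ E(G) := by
  rintro e ⟨x, y, h, -⟩
  exact h.edge_mem

omit [G.Loopless] in
/-- Every vertex is an end of a bichromatic edge, since red half-edges lie on bichromatic edges. -/
lemma IsWStateGraph.exists_bichromatic (hc : c.IsWStateGraph) {v : α} (hv : v ∈ V(G)) :
    ∃ e ∈ c.bichromaticEdges, ∃ w, G.IsLink e v w := by
  obtain ⟨e, h, hred⟩ := hc.vertex_condition v hv
  obtain ⟨w, hw⟩ := h
  refine ⟨e, ⟨hw.edge_mem, fun hmono ↦ ?_⟩, w, hw⟩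
  have := hc.monochromatic_blue e v ⟨w, hw⟩ hmono
  rw [hred] at this
  exact one_ne_zero this

/-- A perfect matching through the bichromatic edge `xy` has only monochromatic edges besides. -/
lemma IsWStateGraph.matchable_sdiff [DecidableEq α] (hc : c.IsWStateGraph) {V : Finset α}
    (hV : ∀ v, v ∈ V ↔ v ∈ V(G)) {e : β} (he : e ∈ c.bichromaticEdges) {x y : α}
    (hxy : G.IsLink e x y) : (G.simpleGraphOn c.monochromaticEdges).Matchable (V \ {x, y}) := by
  obtain ⟨M, hM, heM⟩ := hc.matchingCovered e he.1
  obtain ⟨f, hf⟩ := Set.encard_eq_one.1 (hc.matching_condition M hM)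
  have hef : ∀ g ∈ M, g ∈ c.bichromaticEdges → g = e := by
    intro g hg hgB
    have h1 : g ∈ M ∩ c.bichromaticEdges := ⟨hg, hgB⟩
    have h2 : e ∈ M ∩ c.bichromaticEdges := ⟨heM, he⟩
    rw [hf] at h1 h2
    exact h1.trans h2.symm
  refine hM.matchable (fun a ha ↦ (hV a).1 (by grind)) ?_
  intro a ha g hg b hab
  have hge : g ≠ e := by
    rintro rfl
    have := hab.inc_left.eq_or_eq_of_isLink hxy
    grind
  have hb : ∀ z, G.Inc e z → b ≠ z := by
    rintro z hz rfl
    exact hge ((hM.existsUnique b hab.right_mem).unique ⟨hg, hab.inc_right⟩ ⟨heM, hz⟩)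
  refine ⟨?_, ?_⟩
  · by_contra hmono
    exact hge (hef g hg ⟨hab.edge_mem, hmono⟩)
  · have h1 := (hV b).2 hab.right_mem
    have h2 := hb x hxy.inc_left
    have h3 := hb y hxy.inc_right
    grind

lemma IsWStateGraph.not_matchable [DecidableEq α] (hc : c.IsWStateGraph) {V : Finset α}
    (hV : ∀ v, v ∈ V ↔ v ∈ V(G)) :
    ¬ (G.simpleGraphOn c.monochromaticEdges).Matchable V := by
  intro h
  obtain ⟨M, hMF, -, hME, hM⟩ := exists_matching_of_matchable h
  have h1 := hc.matching_condition M ⟨hME, fun v hv ↦ hM v ((hV v).2 hv)⟩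
  have h2 : M ∩ c.bichromaticEdges = ∅ := by
    ext e
    simp only [Set.mem_inter_iff, Set.mem_empty_iff_false, iff_false]
    exact fun ⟨heM, heB⟩ ↦ heB.2 (hMF heM)
  simp [h2] at h1

/-- Two disjoint bichromatic edges do not extend to a perfect matching. -/
lemma IsWStateGraph.not_matchable_sdiff [DecidableEq α] (hc : c.IsWStateGraph) {V : Finset α}
    (hV : ∀ v, v ∈ V ↔ v ∈ V(G)) {e f : β} (he : e ∈ c.bichromaticEdges)
    (hf : f ∈ c.bichromaticEdges) {x y x' y' : α} (hxy : G.IsLink e x y) (hxy' : G.IsLink f x' y')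
    (hd : Disjoint ({x, y} : Finset α) {x', y'}) :
    ¬ (G.simpleGraphOn E(G)).Matchable (V \ {x, y, x', y'}) := by
  intro h
  obtain ⟨M, -, hMA, hME, hM⟩ := exists_matching_of_matchable h
  have hd' := Finset.disjoint_left.1 hd
  have he' : ∀ z, G.Inc e z ↔ z = x ∨ z = y :=
    fun z ↦ ⟨fun hz ↦ hz.eq_or_eq_of_isLink hxy, by
      rintro (rfl | rfl)
      exacts [hxy.inc_left, hxy.inc_right]⟩
  have hf' : ∀ z, G.Inc f z ↔ z = x' ∨ z = y' :=
    fun z ↦ ⟨fun hz ↦ hz.eq_or_eq_of_isLink hxy', by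
      rintro (rfl | rfl)
      exacts [hxy'.inc_left, hxy'.inc_right]⟩
  have hef : e ≠ f := by
    rintro rfl
    have := (hf' x).1 hxy.inc_left
    grind
  have hPM : G.IsPerfectMatching (insert e (insert f M)) := by
    refine ⟨Set.insert_subset he.1 (Set.insert_subset hf.1 hME), fun v hv ↦ ?_⟩
    by_cases hvA : v ∈ V \ {x, y, x', y'}
    · obtain ⟨g, ⟨hg, hgv⟩, hgu⟩ := hM v hvA
      refine ⟨g, ⟨Or.inr (Or.inr hg), hgv⟩, ?_⟩
      rintro k ⟨rfl | rfl | hk, hkv⟩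
      · have := (he' v).1 hkv
        grind
      · have := (hf' v).1 hkv
        grind
      · exact hgu k ⟨hk, hkv⟩
    · have hvV := (hV v).2 hv
      have hMv : ∀ g ∈ M, ¬ G.Inc g v := fun g hg hgv ↦ hvA (hMA g hg v hgv)
      by_cases hev : G.Inc e v
      · refine ⟨e, ⟨Or.inl rfl, hev⟩, ?_⟩
        rintro k ⟨rfl | rfl | hk, hkv⟩
        · rfl
        · have := (he' v).1 hev
          have := (hf' v).1 hkv
          grind
        · exact absurd hkv (hMv k hk)
      · have hfv : G.Inc f v := by
          rw [hf']
          rw [he'] at hev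
          grind
        refine ⟨f, ⟨Or.inr (Or.inl rfl), hfv⟩, ?_⟩
        rintro k ⟨rfl | rfl | hk, hkv⟩
        · exact absurd hkv hev
        · rfl
        · exact absurd hkv (hMv k hk)
  obtain ⟨g, hg⟩ := Set.encard_eq_one.1 (hc.matching_condition _ hPM)
  have h1 : e ∈ insert e (insert f M) ∩ c.bichromaticEdges := ⟨Or.inl rfl, he⟩
  have h2 : f ∈ insert e (insert f M) ∩ c.bichromaticEdges := ⟨Or.inr (Or.inl rfl), hf⟩
  rw [hg] at h1 h2
  exact hef (h1.trans h2.symm)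

/-- The bichromatic edges of a W-state graph form a cut between factor-critical sets. -/
lemma IsWStateGraph.exists_tightPair [DecidableEq α] (hc : c.IsWStateGraph) {V : Finset α}
    (hV : ∀ v, v ∈ V ↔ v ∈ V(G)) (hne : V.Nonempty) :
    ∃ X Y, (G.simpleGraphOn E(G)).TightPair X Y ∧ X ∪ Y = V ∧
      (∀ e ∈ c.bichromaticEdges, ∀ x y, G.IsLink e x y → x ∈ X ∧ y ∈ Y ∨ x ∈ Y ∧ y ∈ X) ∧
      ∀ e ∈ c.monochromaticEdges, ∀ x ∈ X, ∀ y ∈ Y, ¬ G.IsLink e x y := by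
  obtain ⟨X, Y, hd, hXY, hB, hno⟩ := SimpleGraph.exists_cut
    (G := G.simpleGraphOn c.monochromaticEdges)
    (r := fun x y ↦ ∃ e ∈ c.bichromaticEdges, G.IsLink e x y) hne
    (fun v hv ↦ by
      obtain ⟨e, he, w, hw⟩ := hc.exists_bichromatic ((hV v).1 hv)
      exact ⟨w, e, he, hw⟩)
    (fun x y ⟨e, _, hxy⟩ ↦ ⟨(hV x).2 hxy.left_mem, (hV y).2 hxy.right_mem, hxy.ne⟩)
    (fun x y ⟨e, he, hxy⟩ ↦ hc.matchable_sdiff hV he hxy) (hc.not_matchable hV)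
  have hd' := Finset.disjoint_left.1 hd
  have hcross : ∀ x ∈ X, ∀ y ∈ Y, (G.simpleGraphOn E(G)).Adj x y →
      ∃ e ∈ c.bichromaticEdges, G.IsLink e x y := by
    rintro x hx y hy ⟨e, he, hxy⟩
    exact ⟨e, ⟨he, fun hmono ↦ hno x hx y hy ⟨e, hmono, hxy⟩⟩, hxy⟩
  have hmono : ∀ A, (G.simpleGraphOn c.monochromaticEdges).Matchable A →
      (G.simpleGraphOn E(G)).Matchable A := by
    refine fun A hA ↦ hA.mono ?_
    rintro a - b - ⟨e, he, hab⟩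
    exact ⟨e, hab.edge_mem, hab⟩
  refine ⟨X, Y, ⟨hd, ?_, ?_, ?_, ?_, ?_⟩, hXY, fun e he x y hxy ↦ hB x y ⟨e, he, hxy⟩,
    fun e he x hx y hy hxy ↦ hno x hx y hy ⟨e, he, hxy⟩⟩
  · intro x hx
    obtain ⟨e, he, y, hxy⟩ := hc.exists_bichromatic ((hV x).1 (by grind))
    have hy := hB x y ⟨e, he, hxy⟩
    refine hmono _ ((hc.matchable_sdiff hV he hxy).restrict_of_closed ?_ ?_).1
    · grind
    · intro a ha b hb hba
      exact hno a (by grind) b (by grind)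
  · intro x hx
    obtain ⟨e, he, y, hxy⟩ := hc.exists_bichromatic ((hV x).1 (by grind))
    have hy := hB x y ⟨e, he, hxy⟩
    refine hmono _ ((hc.matchable_sdiff hV he hxy).restrict_of_closed ?_ ?_).1
    · grind
    · intro a ha b hb hba hab
      exact hno b (by grind) a (by grind) hab.symm
  · intro x hx
    obtain ⟨e, he, y, hxy⟩ := hc.exists_bichromatic ((hV x).1 (by grind))
    have hy := hB x y ⟨e, he, hxy⟩
    exact ⟨y, by grind, e, he.1, hxy⟩
  · intro x hx
    obtain ⟨e, he, y, hxy⟩ := hc.exists_bichromatic ((hV x).1 (by grind))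
    have hy := hB x y ⟨e, he, hxy⟩
    exact ⟨y, by grind, e, he.1, hxy⟩
  · intro x hx y hy x' hx' y' hy' hxx hyy hadj hadj'
    obtain ⟨e, he, hxy⟩ := hcross x hx y hy hadj
    obtain ⟨f, hf, hxy'⟩ := hcross x' hx' y' hy' hadj'
    rw [hXY]
    exact hc.not_matchable_sdiff hV he hf hxy hxy' (Finset.disjoint_left.2 (by grind))

omit [G.Loopless] in
/-- A W-state graph is a W-cone with apex `v` if its bichromatic edges are the edges at `v`: all
other vertices are adjacent to `v`, because they meet bichromatic edges. -/
lemma IsWStateGraph.isWConeWithApex (hc : c.IsWStateGraph) {v : α} (hv : v ∈ V(G))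
    (hB : ∀ e ∈ c.bichromaticEdges, ∀ x y, G.IsLink e x y → x = v ∨ y = v)
    (hm : ∀ e ∈ c.monochromaticEdges, ¬ G.Inc e v) : c.IsWConeWithApex v := by
  refine ⟨hc.monochromatic_blue, hc.matchingCovered, ⟨hv, ?_⟩, ?_, ?_, hc.vertex_condition⟩
  · intro u hu huv
    obtain ⟨e, he, w, hw⟩ := hc.exists_bichromatic hu
    obtain rfl := (hB e he u w hw).resolve_left huv
    exact ⟨e, hw.symm⟩
  · ext e
    refine ⟨fun he ↦ ⟨Inc.edge_mem he, fun hmono ↦ hm e hmono he⟩, fun he ↦ ?_⟩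
    obtain ⟨x, y, hxy⟩ := exists_isLink_of_mem_edgeSet he.1
    rcases hB e he x y hxy with rfl | rfl
    · exact hxy.inc_left
    · exact hxy.inc_right
  · ext e
    simp only [edgeSet_induce, Set.mem_ofPred_eq, Set.mem_sdiff, Set.mem_singleton_iff]
    constructor
    · rintro ⟨x, y, hxy, hx, hy⟩
      by_contra hmono
      rcases hB e ⟨hxy.edge_mem, hmono⟩ x y hxy with h | h
      · exact hx.2 h
      · exact hy.2 h
    · intro he
      obtain ⟨x, y, hxy⟩ := exists_isLink_of_mem_edgeSet (monochromaticEdges_subset he)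
      refine ⟨x, y, hxy, ⟨hxy.left_mem, ?_⟩, hxy.right_mem, ?_⟩
      · rintro rfl
        exact hm e he hxy.inc_left
      · rintro rfl
        exact hm e he hxy.inc_right

end HalfEdgeColouring

omit [G.Loopless] in
/-- In a 3-connected graph no nonempty set `D` has all its neighbours in `D ∪ {u, v}` if a further
vertex is left. -/
lemma IsVertexConnected.false_of_closed (h3 : G.IsVertexConnected 3) {D : Set α} {u v d w : α}
    (hu : u ∈ V(G)) (hv : v ∈ V(G)) (hd : d ∈ D) (hdV : d ∈ V(G)) (huD : u ∉ D) (hvD : v ∉ D)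
    (hw : w ∈ V(G)) (hwD : w ∉ D) (hwu : w ≠ u) (hwv : w ≠ v)
    (hcl : ∀ a ∈ D, ∀ b, G.Adj a b → b ∈ D ∨ b = u ∨ b = v) : False := by
  have hcard : ({u, v} : Set α).encard < (3 : ℕ) :=
    (Set.encard_insert_le {v} u).trans_lt (by rw [Set.encard_singleton]; norm_num)
  have hconn := h3.2 {u, v} (by grind) hcard
  have hmem : ∀ a, a ∈ V(G) → a ≠ u → a ≠ v → a ∈ V(G.deleteVerts {u, v}) := by
    intro a ha hau hav
    simp [vertexSet_deleteVerts, ha, hau, hav]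
  have hreach := hconn.preconnected ⟨d, hmem d hdV (by grind) (by grind)⟩ ⟨w, hmem w hw hwu hwv⟩
  refine hwD (hreach.of_closed (p := fun a ↦ a.1 ∈ D) ?_ hd)
  rintro a b ⟨-, e, he⟩ ha
  rw [deleteVerts_isLink] at he
  have := hcl a ha b ⟨e, he.1⟩
  grind

end Graph

theorem mainTheorem6 {α β : Type*} (G : Graph α β) [G.Loopless]
    (hV : V(G).Finite) (hE : E(G).Finite) (c : G.HalfEdgeColouring)
    (hc : c.IsWStateGraph) (h3 : G.IsVertexConnected 3) :
    c.IsWCone := by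
  classical
  have hVm : ∀ v, v ∈ hV.toFinset ↔ v ∈ V(G) := by simp
  have hcard : 3 < hV.toFinset.card := by
    have := h3.1
    rw [hV.encard_eq_coe_toFinset_card] at this
    exact_mod_cast this
  obtain ⟨X, Y, h, hXY, hB, hno⟩ := hc.exists_tightPair hVm
    (Finset.card_pos.1 (show 0 < hV.toFinset.card by omega))
  rw [← hXY] at hcard
  have hd := Finset.disjoint_left.1 h.disjoint
  have hmem : ∀ v, v ∈ X ∪ Y ↔ v ∈ V(G) := fun v ↦ hXY ▸ hVm v
  obtain ⟨z, hz⟩ := Finset.card_pos.1 (show 0 < (X ∪ Y).card by omega)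
  obtain ⟨x, hx, y, hy, hxy⟩ : ∃ x ∈ X, ∃ y ∈ Y, (G.simpleGraphOn E(G)).Adj x y := by
    rcases Finset.mem_union.1 hz with hz | hz
    · obtain ⟨y, hy, hzy⟩ := h.exists_adj_left z hz
      exact ⟨z, hz, y, hy, hzy⟩
    · obtain ⟨x, hx, hzx⟩ := h.exists_adj_right z hz
      exact ⟨x, hx, z, hz, hzx.symm⟩
  by_cases hX : ∀ a ∈ X, a = x
  · refine ⟨x, hc.isWConeWithApex ((hmem x).1 (by grind)) ?_ ?_⟩
    · intro e he a b hab
      have := hB e he a b hab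
      grind
    · rintro e he ⟨w, hw⟩
      have hwV := (hmem w).2 hw.right_mem
      have := hw.ne
      exact hno e he x hx w (by grind) hw
  by_cases hY : ∀ b ∈ Y, b = y
  · refine ⟨y, hc.isWConeWithApex ((hmem y).1 (by grind)) ?_ ?_⟩
    · intro e he a b hab
      have := hB e he a b hab
      grind
    · rintro e he ⟨w, hw⟩
      have hwV := (hmem w).2 hw.right_mem
      have := hw.ne
      exact hno e he w (by grind) y hy hw.symm
  -- If both sides have two vertices, the ends of a leaf separate it from the opposite side.
  push Not at hX hY
  obtain ⟨D, u, v, hD⟩ := h.exists_leaf hx hy hxy (by omega)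
  exfalso
  obtain ⟨d, hdD⟩ := hD.nonempty
  have hu := hD.left_mem
  have hv := hD.right_mem
  obtain ⟨w, hw, hwD, hwu, hwv⟩ : ∃ w ∈ X ∪ Y, w ∉ D ∧ w ≠ u ∧ w ≠ v := by
    rcases hD.side with hDX | hDY
    · obtain ⟨b, hb, hby⟩ := hY
      by_cases hvy : v = y
      · exact ⟨b, by grind, by grind, by grind, by grind⟩
      · exact ⟨y, by grind, by grind, by grind, by grind⟩
    · obtain ⟨a, ha, hax⟩ := hX
      by_cases hux : u = x
      · exact ⟨a, by grind, by grind, by grind, by grind⟩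
      · exact ⟨x, by grind, by grind, by grind, by grind⟩
  have hdV : d ∈ X ∪ Y := by
    rcases hD.side with hside | hside <;> have := hside hdD <;> grind
  refine h3.false_of_closed (D := (D : Set α)) ((hmem u).1 (by grind)) ((hmem v).1 (by grind))
    hdD ((hmem d).1 hdV) hD.left_notMem hD.right_notMem ((hmem w).1 hw) hwD hwu hwv ?_
  rintro a ha b ⟨e, hab⟩
  exact hD.closed a ha b ((hmem b).2 hab.right_mem) ⟨e, hab.edge_mem, hab⟩
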